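/- Let $T$ be a finite tree with vertex set $V$ and edge set $E$, regarded as a quantum network: each vertex is a party, and each edge is a bipartite source distributing an arbitrary quantum state to the two parties at its ends (a product of such source states is a $T$-state). All parties hold finite-dimensional systems. A *step* is a block of communication in which each acting party performs a local measurement and sends classical information only to neighbours in $T$, no party both sends and receives information within the step, and the parties then apply local operations depending on the information received. For a state $\sigma$ of the parties, let $r_c(\sigma|T)$ be the minimal number of steps of an LOCC protocol (local operations, free shared randomness, and steps as above, with systems of arbitrary finite dimension) that prepares $\sigma$ from $T$-states to arbitrary accuracy. The network communication cost of a state $\rho$ is $$\mathcal{E}_c(\rho|T)=\min_{p_i,\rho_i}\sum_i p_i\, r_c(\rho_i|T),$$ over all finite convex decompositions $\rho=\sum_i p_i\rho_i$ into states, and the edge radius of $T$ is $$r_c(T)=\min_{e\in E}\ \max_{u\in V}\ \min_{v\in e}\ \operatorname{dis}(u,v).$$ Let $\rho$ be a pure state of the parties such that, for the two distinct parties $a\neq b$ at the ends of some longest path in $T$, the reduced state $\rho_{ab}$ is entangled (not separable). Then $$\mathcal{E}_c(\rho|T)=r_c(T),$$ the minimum that defines $\mathcal{E}_c(\rho|T)$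 being attained. In particular, if $T$ is the line graph (path) $L_n$ on $n$ vertices, then $\mathcal{E}_c(\rho|L_n)=\lceil n/2\rceil-1$. -/

import Mathlib

open scoped ENNReal NNReal ComplexOrder

universe u

namespace QNet

/-- A density matrix: positive semidefinite with unit trace. -/
def IsDensity {ι : Type*} [Fintype ι] (ρ : Matrix ι ι ℂ) : Prop :=
  ρ.PosSemidef ∧ ρ.trace = 1

/-- A pure state: `ρ = |ψ⟩⟨ψ|` for a unit vector `ψ`. -/
def IsPure {ι : Type*} [Fintype ι] (ρ : Matrix ι ι ℂ) : Prop :=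
  ∃ ψ : ι → ℂ, ∑ i, ‖ψ i‖ ^ 2 = 1 ∧ ρ = Matrix.vecMulVec ψ (star ψ)

/-- A bipartite state is separable if it is a finite convex combination of product states. -/
def IsSeparable {A B : Type*} [Fintype A] [Fintype B] (σ : Matrix (A × B) (A × B) ℂ) : Prop :=
  ∃ (n : ℕ) (p : Fin n → ℝ≥0) (α : Fin n → Matrix A A ℂ) (β : Fin n → Matrix B B ℂ),
    ∑ i, p i = 1 ∧ (∀ i, IsDensity (α i)) ∧ (∀ i, IsDensity (β i)) ∧
      σ = ∑ i, (p i : ℝ) • Matrix.kroneckerMap (· * ·) (α i) (β i)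

/-- A bipartite state is entangled if it is not separable. -/
def IsEntangled {A B : Type*} [Fintype A] [Fintype B] (σ : Matrix (A × B) (A × B) ℂ) : Prop :=
  ¬ IsSeparable σ

section Parties

variable {V : Type u}

/-- Operators on the multipartite space `⨂ v, ℂ^(D v)`, written as matrices in the product basis:
party `v` holds a system with orthonormal basis labelled by the finite type `D v`. -/
abbrev Op (D : V → Type u) : Type u := Matrix (∀ v, D v) (∀ v, D v) ℂ

/-- The product operator `⨂ v, K v`. -/
def tensorOp [Fintype V] {D D' : V → Type u} (K : ∀ v, Matrix (D' v) (D v) ℂ) :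
    Matrix (∀ v, D' v) (∀ v, D v) ℂ :=
  Matrix.of fun i j => ∏ v, K v (i v) (j v)

/-- The two-party reduced state `ρ_{uv}` (for `u ≠ v`): the partial trace over all other parties.
The entry at `(a, b)` sums `ρ i j` over those `i`, `j` which carry the labels `a`, resp. `b`, at
`u, v`, and which agree at every other party. -/
def reducedPair [Fintype V] [DecidableEq V] {D : V → Type u} [∀ v, Fintype (D v)]
    [∀ v, DecidableEq (D v)] (ρ : Op D) (u v : V) : Matrix (D u × D v) (D u × D v) ℂ :=
  Matrix.of fun a b => ∑ i : (∀ w, D w),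
    if i u = a.1 ∧ i v = a.2 then
      ρ i (Function.update (Function.update i u b.1) v b.2) else 0

/-- The data of a `G`-state: every edge `e` of `G` carries a bipartite source, which emits an
arbitrary state `γ e` and gives a particle, with basis `S e v`, to each of the two parties
`v ∈ e`. -/
structure GState [Fintype V] [DecidableEq V] (G : SimpleGraph V) where
  S : Sym2 V → V → Type u
  [fin : ∀ e v, Fintype (S e v)]
  [dec : ∀ e v, DecidableEq (S e v)]
  γ : ∀ e : G.edgeSet, Matrix (∀ v : {v // v ∈ e.1}, S e v) (∀ v : {v // v ∈ e.1}, S e v) ℂ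
  density : ∀ e, IsDensity (γ e)

attribute [instance] GState.fin GState.dec

/-- Party `v` holds one particle from each source on an edge incident to `v`. -/
abbrev GState.Local [Fintype V] [DecidableEq V] {G : SimpleGraph V} (σ : GState G) (v : V) : Type u :=
  ∀ e : {e : G.edgeSet // v ∈ e.1}, σ.S e.1 v

/-- The joint state `⨂ e, γ e`, its tensor factors being grouped by party. -/
def GState.state [Fintype V] [DecidableEq V] {G : SimpleGraph V} [DecidableRel G.Adj]
    (σ : GState G) : Op σ.Local :=
  Matrix.of fun i j => ∏ e : G.edgeSet,
    σ.γ e (fun v => i v.1 ⟨e, v.2⟩) (fun v => j v.1 ⟨e, v.2⟩)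

/-- A block of simultaneous local measurements in the network `G`. Each party `v` applies a local
instrument with one Kraus operator for each of its outcomes `out v`. If `sends v w`, then `v`
communicates its outcome to `w`, which may choose its instrument accordingly. Information is sent
only to neighbours in `G`, and a party that receives information does not send any. -/
structure Step (G : SimpleGraph V) (D D' : V → Type u) [∀ v, Fintype (D v)]
    [∀ v, DecidableEq (D v)] [∀ v, Fintype (D' v)] where
  sends : V → V → Prop
  adj : ∀ v w, sends v w → G.Adj v w
  not_both : ∀ v w x, sends v w → ¬ sends w x
  out : V → Type u
  [fin : ∀ v, Fintype (out v)]
  [nonempty : ∀ v, Nonempty (out v)]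
  /-- The Kraus operator of `v`, given its own outcome and the messages it has received. -/
  kraus : ∀ v, out v → (∀ w, sends w v → out w) → Matrix (D' v) (D v) ℂ
  complete : ∀ v (r : ∀ w, sends w v → out w),
    ∑ i, (kraus v i r).conjTranspose * kraus v i r = 1

attribute [instance] Step.fin Step.nonempty

/-- The quantum channel `ρ ↦ ∑ₘ Kₘ ρ Kₘ†`, with `Kₘ` the product of the Kraus operators of all
parties, given the list `m` of all outcomes. -/
def Step.map [Fintype V] [DecidableEq V] {G : SimpleGraph V} {D D' : V → Type u}
    [∀ v, Fintype (D v)] [∀ v, DecidableEq (D v)] [∀ v, Fintype (D' v)]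
    (s : Step G D D') (ρ : Op D) : Op D' :=
  ∑ m : (∀ v, s.out v),
    tensorOp (fun v => s.kraus v (m v) (fun w _ => m w)) * ρ *
      (tensorOp (fun v => s.kraus v (m v) (fun w _ => m w))).conjTranspose

/-- `IsLOCC G D k D' Λ`: the map `Λ` from systems `D` to systems `D'` is realised by an LOCC
protocol with `k` steps of classical communication in the network `G`. Local operations without
communication cost nothing. The sizes of the local systems are unrestricted, so that the parties
can keep classical records in them. -/
inductive IsLOCC [Fintype V] [DecidableEq V] (G : SimpleGraph V) (D : V → Type u)
    [∀ v, Fintype (D v)] [∀ v, DecidableEq (D v)] :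
    ℕ → ∀ (D' : V → Type u) [∀ v, Fintype (D' v)] [∀ v, DecidableEq (D' v)],
      (Op D → Op D') → Prop
  | refl : IsLOCC G D 0 D id
  | localOp {k : ℕ} {D' D'' : V → Type u} [∀ v, Fintype (D' v)] [∀ v, DecidableEq (D' v)]
      [∀ v, Fintype (D'' v)] [∀ v, DecidableEq (D'' v)] {Λ : Op D → Op D'}
      (s : Step G D' D'') (hs : ∀ v w, ¬ s.sends v w) (h : IsLOCC G D k D' Λ) :
      IsLOCC G D k D'' (s.map ∘ Λ)
  | step {k : ℕ} {D' D'' : V → Type u} [∀ v, Fintype (D' v)] [∀ v, DecidableEq (D' v)]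
      [∀ v, Fintype (D'' v)] [∀ v, DecidableEq (D'' v)] {Λ : Op D → Op D'}
      (s : Step G D' D'') (h : IsLOCC G D k D' Λ) :
      IsLOCC G D (k + 1) D'' (s.map ∘ Λ)

variable [Fintype V] [DecidableEq V] {D : V → Type u} [∀ v, Fintype (D v)]
  [∀ v, DecidableEq (D v)]

/-- The states of the systems `D` that can be prepared exactly from some `G`-state by an LOCC
protocol with `k` steps, assisted by shared randomness `i` of distribution `p` (which is free). -/
def preparable (G : SimpleGraph V) [DecidableRel G.Adj] (k : ℕ) : Set (Op D) :=
  {ρ | ∃ (σ : GState G) (n : ℕ) (p : Fin n → ℝ≥0) (Λ : Fin n → Op σ.Local → Op D),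
    ∑ i, p i = 1 ∧ (∀ i, IsLOCC G σ.Local k D (Λ i)) ∧ ρ = ∑ i, (p i : ℝ) • Λ i σ.state}

/-- `r_c(ρ|G)`: the minimal number of steps that prepare `ρ` from `G`-states to arbitrary accuracy
(`⊤` if no number of steps is enough). -/
noncomputable def stepNumber (G : SimpleGraph V) [DecidableRel G.Adj] (ρ : Op D) : ℕ∞ :=
  ⨅ k ∈ {k : ℕ | ρ ∈ closure (preparable G k)}, (k : ℕ∞)

/-- The average numbers of steps `∑ i, p i * r_c(ρ i|G)` over all finite convex decompositions
`ρ = ∑ i, p i • ρ i` into states. -/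
def averageSteps (G : SimpleGraph V) [DecidableRel G.Adj] (ρ : Op D) : Set ℝ≥0∞ :=
  {c | ∃ (n : ℕ) (p : Fin n → ℝ≥0) (τ : Fin n → Op D),
    ∑ i, p i = 1 ∧ (∀ i, IsDensity (τ i)) ∧ ρ = ∑ i, (p i : ℝ) • τ i ∧
      c = ∑ i, (p i : ℝ≥0∞) * (stepNumber G (τ i) : ℝ≥0∞)}

/-- The network communication cost `E_c(ρ|G)`. -/
noncomputable def communicationCost (G : SimpleGraph V) [DecidableRel G.Adj] (ρ : Op D) : ℝ≥0∞ :=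
  sInf (averageSteps G ρ)

end Parties

/-- The edge radius `r_c(G) = min_{e ∈ E} max_{u ∈ V} min_{v ∈ e} dis(u, v)`. -/
noncomputable def edgeRadius {V : Type u} (G : SimpleGraph V) : ℕ∞ :=
  ⨅ e ∈ G.edgeSet, ⨆ u : V, ⨅ v ∈ e, G.edist u v

end QNet

set_option linter.unusedSectionVars false

namespace QNet

/-! A pure state is an extreme point of the set of density matrices, so each decomposition of `ρ`
repeats `ρ` and the cost is just the step number of `ρ` (`averageSteps_eq_of_isPure`). It remains to
show that this number is the edge radius, which for a tree is half the length of a longest path,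
rounded down (`edgeRadius_eq`).

Lower bound: a light-cone argument in the Heisenberg picture. As no party both receives and sends
within a step, an observable on a set of parties pulls back through a step to one on the set and its
neighbours. After `k` steps the parties `a` and `b` thus depend only on the balls of radius `k`
around them. If every walk from `a` to `b` is longer than `2 * k + 1`, these balls are disjoint and
share no source, so each value of the shared randomness leaves `a` and `b` in a product state
(`IsLOCC.uncorrelated`, `GState.uncorrelated_state`). The mixture is separable, and separability
survives limits because the separable states form a compact set.

Upper bound: teleportation outwards from a central edge. The source on that edge emits all of `ρ`,
each party's system going to the end of the edge from which that party descends; all other sources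
emit maximally entangled states. In step `t + 1` the parties at depth `t` measure and inform their
children, who correct at once, so the number of steps is the depth of the forest. Each branch of
outcomes yields the same vector up to a scalar (`Routing.teleport_mulVec_stage`,
`Routing.readout_mulVec_stage`); the total scalar is 1 because the protocol preserves the trace. -/

/-! ### Compactness of the set of separable states -/

theorem sum_extend_zero {ι κ F : Type*} [Fintype ι] [Fintype κ] [AddCommMonoid F] (f : ι ↪ κ)
    (g : ι → F) : ∑ j, Function.extend f g 0 j = ∑ i, g i := by
  rw [← Finset.sum_subset (Finset.subset_univ (Finset.univ.map f))]
  · simp [f.injective.extend_apply]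
  · intro j _ hj
    rw [Function.extend_apply']
    · rfl
    · simpa using hj

/-- Carathéodory: `finrank + 1` points suffice, so the hull is a continuous image of a simplex times
a power of `s`. -/
theorem isCompact_convexHull {E : Type*} [AddCommGroup E] [Module ℝ E] [TopologicalSpace E]
    [ContinuousAdd E] [ContinuousSMul ℝ E] [FiniteDimensional ℝ E] {s : Set E} (hs : IsCompact s) :
    IsCompact (convexHull ℝ s) := by
  rcases s.eq_empty_or_nonempty with rfl | ⟨x₀, hx₀⟩
  · simp
  set n := Module.finrank ℝ E + 1 with hn
  have hK : IsCompact (stdSimplex ℝ (Fin n) ×ˢ Set.pi Set.univ fun _ : Fin n => s) :=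
    (isCompact_stdSimplex ℝ (Fin n)).prod (isCompact_univ_pi fun _ => hs)
  have hf : Continuous fun q : (Fin n → ℝ) × (Fin n → E) => ∑ i, q.1 i • q.2 i := by fun_prop
  convert hK.image hf
  ext x
  constructor
  · intro hx
    obtain ⟨ι, _, z, w, hz, hai, hw, hw1, rfl⟩ := eq_pos_convex_span_of_mem_convexHull hx
    have hcard : Fintype.card ι ≤ n :=
      hai.card_le_finrank_succ.trans (Nat.succ_le_succ (Submodule.finrank_le _))
    obtain ⟨f⟩ : Nonempty (ι ↪ Fin n) :=
      Function.Embedding.nonempty_of_card_le (by simpa using hcard)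
    -- Fewer points may occur; the spare slots get weight 0 and the dummy point `x₀`.
    refine ⟨⟨Function.extend f w 0, Function.extend f z fun _ => x₀⟩, ⟨⟨?_, ?_⟩, ?_⟩, ?_⟩
    · intro j
      by_cases hj : ∃ i, f i = j
      · obtain ⟨i, rfl⟩ := hj
        simpa [f.injective.extend_apply] using (hw i).le
      · simp [Function.extend_apply' _ _ _ hj]
    · rw [sum_extend_zero, hw1]
    · intro j _
      by_cases hj : ∃ i, f i = j
      · obtain ⟨i, rfl⟩ := hj
        simpa [f.injective.extend_apply] using hz ⟨i, rfl⟩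
      · simpa [Function.extend_apply' _ _ _ hj] using hx₀
    · rw [← sum_extend_zero f]
      refine Finset.sum_congr rfl fun j _ => ?_
      by_cases hj : ∃ i, f i = j
      · obtain ⟨i, rfl⟩ := hj
        simp [f.injective.extend_apply]
      · simp [Function.extend_apply' _ _ _ hj]
  · rintro ⟨⟨w, z⟩, ⟨⟨hw, hw1⟩, hz⟩, rfl⟩
    exact (convex_convexHull ℝ s).sum_mem (fun i _ => hw i) hw1
      fun i _ => subset_convexHull ℝ s (hz i trivial)

theorem trace_conjTranspose_mul_self_eq {A : Type*} [Fintype A] (B : Matrix A A ℂ) :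
    (B.conjTranspose * B).trace = ((∑ i, ∑ j, ‖B i j‖ ^ 2 : ℝ) : ℂ) := by
  simp only [Matrix.trace, Matrix.diag, Matrix.mul_apply, Matrix.conjTranspose_apply]
  rw [Finset.sum_comm]
  push_cast
  refine Finset.sum_congr rfl fun i _ => Finset.sum_congr rfl fun j _ => ?_
  rw [← Complex.conj_mul']
  rfl

/-- Density matrices are the `Bᴴ * B` with `B` in the Hilbert–Schmidt unit sphere, since the trace
of `Bᴴ * B` is the squared norm of `B`. -/
theorem isCompact_setOf_isDensity {A : Type*} [Fintype A] :
    IsCompact {α : Matrix A A ℂ | IsDensity α} := by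
  classical
  have hK : IsCompact {B : A → A → ℂ | ∑ i, ∑ j, ‖B i j‖ ^ 2 = 1} := by
    refine Metric.isCompact_of_isClosed_isBounded (isClosed_eq (by fun_prop) continuous_const) ?_
    refine (Metric.isBounded_closedBall (x := (0 : A → A → ℂ)) (r := 1)).subset fun B hB => ?_
    rw [mem_closedBall_zero_iff, pi_norm_le_iff_of_nonneg zero_le_one]
    intro i
    rw [pi_norm_le_iff_of_nonneg zero_le_one]
    intro j
    have h1 : ‖B i j‖ ^ 2 ≤ 1 := by
      rw [← hB.out]
      refine (Finset.single_le_sum (f := fun j => ‖B i j‖ ^ 2) (fun _ _ => by positivity)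
        (Finset.mem_univ j)).trans ?_
      exact Finset.single_le_sum (f := fun i => ∑ j, ‖B i j‖ ^ 2)
        (fun _ _ => by positivity) (Finset.mem_univ i)
    exact (sq_le_one_iff₀ (norm_nonneg _)).1 h1
  have hf : Continuous fun B : A → A → ℂ => (Matrix.of B).conjTranspose * Matrix.of B := by
    have : Continuous fun B : A → A → ℂ => (Matrix.of B : Matrix A A ℂ) := continuous_id
    fun_prop
  convert hK.image hf
  ext α
  constructor
  · rintro ⟨h1, h2⟩
    obtain ⟨B, rfl⟩ : ∃ B : Matrix A A ℂ, α = B.conjTranspose * B := by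
      open scoped MatrixOrder in
      have := CStarAlgebra.nonneg_iff_eq_star_mul_self.1 h1.nonneg
      exact this
    refine ⟨B, ?_, rfl⟩
    rw [trace_conjTranspose_mul_self_eq] at h2
    exact_mod_cast h2
  · rintro ⟨B, hB, rfl⟩
    refine ⟨Matrix.posSemidef_conjTranspose_mul_self _, ?_⟩
    rw [trace_conjTranspose_mul_self_eq]
    exact_mod_cast hB

theorem setOf_isSeparable_eq_convexHull {A B : Type*} [Fintype A] [Fintype B] :
    {σ : Matrix (A × B) (A × B) ℂ | IsSeparable σ} =
      convexHull ℝ ((fun q : Matrix A A ℂ × Matrix B B ℂ =>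
        Matrix.kroneckerMap (· * ·) q.1 q.2) '' ({α | IsDensity α} ×ˢ {β | IsDensity β})) := by
  ext σ
  constructor
  · rintro ⟨n, p, α, β, hp, hα, hβ, rfl⟩
    refine (convex_convexHull ℝ _).sum_mem (fun i _ => (p i).2) (by exact_mod_cast hp)
      fun i _ => subset_convexHull ℝ _ ⟨(α i, β i), ⟨hα i, hβ i⟩, rfl⟩
  · intro h
    obtain ⟨ι, _, z, w, hz, -, hw, hw1, rfl⟩ := eq_pos_convex_span_of_mem_convexHull h
    choose q hq hqz using fun i => hz ⟨i, rfl⟩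
    let e := (Fintype.equivFin ι).symm
    refine ⟨Fintype.card ι, fun i => (w (e i)).toNNReal, fun i => (q (e i)).1,
      fun i => (q (e i)).2, ?_, fun i => (hq _).1, fun i => (hq _).2, ?_⟩
    · apply NNReal.coe_injective
      push_cast
      rw [← hw1, ← e.sum_comp]
      exact Finset.sum_congr rfl fun i _ => Real.coe_toNNReal _ (hw _).le
    · rw [← e.sum_comp]
      refine Finset.sum_congr rfl fun i _ => ?_
      rw [← hqz, Real.coe_toNNReal _ (hw _).le]

theorem isClosed_setOf_isSeparable {A B : Type*} [Fintype A] [Fintype B] :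
    IsClosed {σ : Matrix (A × B) (A × B) ℂ | IsSeparable σ} := by
  rw [setOf_isSeparable_eq_convexHull]
  refine (isCompact_convexHull ?_).isClosed
  refine (isCompact_setOf_isDensity.prod isCompact_setOf_isDensity).image ?_
  refine continuous_matrix fun i j => ?_
  simp only [Matrix.kroneckerMap_apply]
  exact (continuous_fst.matrix_elem _ _).mul (continuous_snd.matrix_elem _ _)

/-! ### Pure states are extreme points -/

theorem isDensity_vecMulVec {ι : Type*} [Fintype ι] {ψ : ι → ℂ} (hψ : ∑ i, ‖ψ i‖ ^ 2 = 1) :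
    IsDensity (Matrix.vecMulVec ψ (star ψ)) := by
  refine ⟨Matrix.posSemidef_vecMulVec_self_star ψ, ?_⟩
  rw [Matrix.trace_vecMulVec, dotProduct]
  simp only [Pi.star_apply]
  have : ∀ i, ψ i * star (ψ i) = ((‖ψ i‖ ^ 2 : ℝ) : ℂ) := fun i => by
    simpa using Complex.mul_conj' (ψ i)
  simp only [this]
  exact_mod_cast hψ

/-- A pure state has no proper convex decomposition. -/
theorem IsPure.eq_of_sum {ι : Type*} [Fintype ι] {ρ : Matrix ι ι ℂ} (hρ : IsPure ρ) {n : ℕ}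
    {p : Fin n → ℝ≥0} {τ : Fin n → Matrix ι ι ℂ} (hτ : ∀ i, IsDensity (τ i))
    (h : ρ = ∑ i, (p i : ℝ) • τ i) {i : Fin n} (hi : p i ≠ 0) : τ i = ρ := by
  classical
  obtain ⟨ψ, hψ, rfl⟩ := hρ
  set P := Matrix.vecMulVec ψ (star ψ) with hP
  have hdot : star ψ ⬝ᵥ ψ = 1 := by
    have := (isDensity_vecMulVec hψ).2
    rwa [Matrix.trace_vecMulVec, dotProduct_comm] at this
  -- On the complement of `ψ` the form of `ρ` vanishes; it is a sum of nonnegative terms, so each `τ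
  -- i` of positive weight vanishes there too. Hence `τ i = P * τ i * P`, a multiple of `P`.
  have hker : ∀ φ : ι → ℂ, star ψ ⬝ᵥ φ = 0 → (τ i).mulVec φ = 0 := by
    intro φ hφ
    have h0 : star φ ⬝ᵥ P.mulVec φ = 0 := by
      rw [hP, Matrix.vecMulVec_mulVec, hφ]
      simp
    rw [h, Matrix.sum_mulVec, dotProduct_sum] at h0
    have hnn : ∀ j ∈ Finset.univ, 0 ≤ star φ ⬝ᵥ ((p j : ℝ) • τ j).mulVec φ := by
      intro j _
      rw [Matrix.smul_mulVec, dotProduct_smul]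
      exact smul_nonneg (p j).2 ((hτ j).1.dotProduct_mulVec_nonneg φ)
    have h1 := (Finset.sum_eq_zero_iff_of_nonneg hnn).1 h0 i (Finset.mem_univ i)
    rw [Matrix.smul_mulVec, dotProduct_smul, smul_eq_zero] at h1
    rcases h1 with h1 | h1
    · exact absurd (by exact_mod_cast h1) hi
    · exact ((hτ i).1.dotProduct_mulVec_zero_iff φ).1 h1
  have hright : τ i = τ i * P := by
    refine Matrix.ext_of_mulVec_single fun j => ?_
    generalize (Pi.single j 1 : ι → ℂ) = φ
    have h2 := hker (φ - (star ψ ⬝ᵥ φ) • ψ) (by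
      rw [dotProduct_sub, dotProduct_smul, hdot]; simp)
    rw [Matrix.mulVec_sub, sub_eq_zero] at h2
    rw [h2, ← Matrix.mulVec_mulVec, hP, Matrix.vecMulVec_mulVec]
    simp
  have hPh : P.conjTranspose = P := (isDensity_vecMulVec hψ).1.1
  have hleft : τ i = P * τ i := by
    have := congrArg Matrix.conjTranspose hright
    rwa [Matrix.conjTranspose_mul, hPh, (hτ i).1.1] at this
  have hc : τ i = (star ψ ⬝ᵥ (τ i).mulVec ψ) • P := by
    conv_lhs => rw [hright, hP, Matrix.mul_vecMulVec]
    conv_lhs => rw [hleft, ← Matrix.mulVec_mulVec, hP, Matrix.vecMulVec_mulVec]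
    ext a b
    simp [Matrix.vecMulVec_apply, hP, mul_comm, mul_assoc, mul_left_comm]
  have htr := (hτ i).2
  rw [hc, Matrix.trace_smul, (isDensity_vecMulVec hψ).2, smul_eq_mul, mul_one] at htr
  rw [hc, htr, one_smul]

section Cost

variable {V : Type u} [Fintype V] [DecidableEq V] {D : V → Type u} [∀ v, Fintype (D v)]
  [∀ v, DecidableEq (D v)]

/-- By extremality only terms of weight zero can differ from `ρ`, and they contribute nothing even
if their step number is `⊤`, since `0 * ⊤ = 0`. -/
theorem averageSteps_eq_of_isPure (G : SimpleGraph V) [DecidableRel G.Adj] {ρ : Op D}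
    (hρ : IsPure ρ) : averageSteps G ρ = {(stepNumber G ρ : ℝ≥0∞)} := by
  ext c
  constructor
  · rintro ⟨n, p, τ, hp, hτ, h, rfl⟩
    have : ∀ i, (p i : ℝ≥0∞) * (stepNumber G (τ i) : ℝ≥0∞) =
        (p i : ℝ≥0∞) * (stepNumber G ρ : ℝ≥0∞) := by
      intro i
      by_cases hi : p i = 0
      · simp [hi]
      · rw [hρ.eq_of_sum hτ h hi]
    simp only [this]
    rw [← Finset.sum_mul, ← ENNReal.ofNNReal_finsetSum, hp]
    simp
  · rintro rfl
    refine ⟨1, fun _ => 1, fun _ => ρ, by simp, fun _ => ?_, by simp, by simp⟩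
    obtain ⟨ψ, hψ, rfl⟩ := hρ
    exact isDensity_vecMulVec hψ

end Cost

/-! ### Averaging over independent outcomes -/

section Sums

variable {V : Type*} [Fintype V] [DecidableEq V] {out : V → Type*} [∀ v, Fintype (out v)]

theorem sum_sum_update {M : Type*} [AddCommMonoid M] (f : (∀ v, out v) → M) (v : V) :
    ∑ m, ∑ c, f (Function.update m v c) = Fintype.card (out v) • ∑ m, f m := by
  let e := Equiv.piSplitAt v out
  have hu : ∀ (c c' : out v) (r : ∀ j : {j // j ≠ v}, out j),
      Function.update (e.symm (c', r)) v c = e.symm (c, r) := by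
    intro c c' r
    ext w
    by_cases h : w = v
    · subst h; simp [e, Equiv.piSplitAt]
    · simp [e, Equiv.piSplitAt, h]
  rw [← e.symm.sum_comp, ← e.symm.sum_comp f, Fintype.sum_prod_type, Fintype.sum_prod_type]
  simp only [hu]
  rw [Finset.sum_const, Finset.card_univ, Finset.sum_comm]

/-- Functions of disjoint sets of coordinates are independent under the uniform distribution. -/
theorem card_mul_sum_mul_eq_sum_mul_sum {R : Type*} [CommSemiring R] (P : V → Prop)
    [DecidablePred P] (f g : (∀ v, out v) → R)
    (hf : ∀ m m', (∀ v, P v → m v = m' v) → f m = f m')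
    (hg : ∀ m m', (∀ v, ¬ P v → m v = m' v) → g m = g m') :
    (Fintype.card (∀ v, out v) : R) * ∑ m, f m * g m = (∑ m, f m) * ∑ m, g m := by
  -- Exchanging the coordinates outside `P` between `m` and `m'` turns `f m * g m'` into `f m * g
  -- m`.
  let mg : (∀ v, out v) → (∀ v, out v) → ∀ v, out v := fun m m' v => if P v then m v else m' v
  have hinv : Function.Involutive
      fun q : (∀ v, out v) × (∀ v, out v) => (mg q.1 q.2, mg q.2 q.1) := by
    rintro ⟨m, m'⟩
    ext v <;> by_cases h : P v <;> simp [mg, h]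
  rw [Finset.sum_mul_sum, ← Fintype.sum_prod_type' (f := fun m m' => f m * g m'),
    ← Equiv.sum_comp (hinv.toPerm _), Fintype.sum_prod_type]
  have h1 : ∀ m m', f (mg m m') * g (mg m' m) = f m * g m := by
    intro m m'
    rw [hf (mg m m') m fun v h => by simp [mg, h], hg (mg m' m) m fun v h => by simp [mg, h]]
  simp only [Function.Involutive.coe_toPerm, h1]
  rw [Finset.sum_congr rfl fun m _ => Finset.sum_const _, Finset.card_univ, ← Finset.smul_sum,
    nsmul_eq_mul]

/-- Averaging out outcomes each of which influences only a single factor. -/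
theorem sum_multilinear_eq_of_average {E : V → Type*} [∀ v, AddCommGroup (E v)]
    [∀ v, Module ℂ (E v)] [∀ v, Nonempty (out v)] (Φ : MultilinearMap ℂ E ℂ)
    (Y : ∀ v, E v) (Q : Finset V) (F : (∀ v, out v) → ∀ v, E v)
    (h1 : ∀ v ∈ Q, ∀ w, w ≠ v → ∀ m c, F (Function.update m v c) w = F m w)
    (h2 : ∀ v ∈ Q, ∀ m, ∑ c, F (Function.update m v c) v = (Fintype.card (out v) : ℂ) • Y v) :
    ∑ m, Φ (F m) = ∑ m, Φ (fun v => if v ∈ Q then Y v else F m v) := by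
  induction Q using Finset.induction_on generalizing F with
  | empty => simp
  | insert v Q hv ih =>
    have hc : (Fintype.card (out v) : ℂ) ≠ 0 := by exact_mod_cast Fintype.card_ne_zero
    have hF : ∀ m c, F (Function.update m v c) =
        Function.update (F m) v (F (Function.update m v c) v) := by
      intro m c
      ext w
      by_cases hw : w = v
      · subst hw; simp
      · simp [hw, h1 v (Finset.mem_insert_self v Q) w hw]
    have hstep : ∑ m, Φ (F m) = ∑ m, Φ (Function.update (F m) v (Y v)) := by
      apply mul_left_cancel₀ hc
      rw [← nsmul_eq_mul, ← sum_sum_update (fun m => Φ (F m)) v, Finset.mul_sum]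
      refine Finset.sum_congr rfl fun m _ => ?_
      rw [Finset.sum_congr rfl fun c _ => congrArg Φ (hF m c), ← MultilinearMap.map_update_sum,
        h2 v (Finset.mem_insert_self v Q), MultilinearMap.map_update_smul, smul_eq_mul]
    rw [hstep, ih (fun m => Function.update (F m) v (Y v))]
    · refine Finset.sum_congr rfl fun m _ => congrArg Φ ?_
      ext w
      by_cases hw : w = v
      · subst hw; simp [hv]
      · simp [hw]
    · intro w hw x hx m c
      by_cases hxv : x = v
      · subst hxv; simp
      · simp [hxv, h1 w (Finset.mem_insert_of_mem hw) x hx]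
    · intro w hw m
      have hwv : w ≠ v := fun h => hv (h ▸ hw)
      simpa [hwv] using h2 w (Finset.mem_insert_of_mem hw) m

end Sums

/-! ### Product observables and uncorrelated sets of parties -/

section Tensor

variable {V : Type u} [Fintype V]

theorem tensorOp_mul [DecidableEq V] {D D' D'' : V → Type u} [∀ v, Fintype (D' v)]
    (K : ∀ v, Matrix (D'' v) (D' v) ℂ) (L : ∀ v, Matrix (D' v) (D v) ℂ) :
    tensorOp K * tensorOp L = tensorOp fun v => K v * L v := by
  ext i j
  simp only [tensorOp, Matrix.mul_apply, Matrix.of_apply, ← Finset.prod_mul_distrib]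
  rw [Finset.prod_univ_sum, Fintype.piFinset_univ]

theorem conjTranspose_tensorOp {D D' : V → Type u} (K : ∀ v, Matrix (D' v) (D v) ℂ) :
    (tensorOp K).conjTranspose = tensorOp fun v => (K v).conjTranspose := by
  ext i j
  simp [tensorOp, Matrix.conjTranspose_apply]

theorem tensorOp_one {D : V → Type u} [∀ v, DecidableEq (D v)] :
    tensorOp (fun v => (1 : Matrix (D v) (D v) ℂ)) = 1 := by
  ext i j
  simp only [tensorOp, Matrix.of_apply, Matrix.one_apply]
  rw [Fintype.prod_ite_zero]
  simp [funext_iff]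

variable [decV : DecidableEq V] {D : V → Type u} [∀ v, Fintype (D v)]

theorem tensorOp_update (X : ∀ v, Matrix (D v) (D v) ℂ) (v : V) (Y : Matrix (D v) (D v) ℂ)
    (i j : ∀ v, D v) : tensorOp (Function.update X v Y) i j =
      Y (i v) (j v) * ∏ w ∈ Finset.univ.erase v, X w (i w) (j w) := by
  rw [tensorOp, Matrix.of_apply, ← Finset.mul_prod_erase _ _ (Finset.mem_univ v)]
  congr 1
  · simp
  · exact Finset.prod_congr rfl fun w hw => by simp [Finset.ne_of_mem_erase hw]

/-- The expectation value `tr (ρ ⨂ᵥ X v)`, as a multilinear function of the `X v`. -/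
noncomputable def expectation (ρ : Op D) :
    MultilinearMap ℂ (fun v => Matrix (D v) (D v) ℂ) ℂ where
  toFun X := (ρ * tensorOp X).trace
  map_update_add' {inst} X v Y Z := by
    obtain rfl : inst = decV := Subsingleton.elim _ _
    rw [← Matrix.trace_add, ← mul_add]
    congr 2
    ext i j
    simp only [Matrix.add_apply, tensorOp_update, add_mul]
  map_update_smul' {inst} X v a Y := by
    obtain rfl : inst = decV := Subsingleton.elim _ _
    rw [← Matrix.trace_smul, ← Matrix.mul_smul]
    congr 2
    ext i j
    simp only [Matrix.smul_apply, tensorOp_update, smul_mul_assoc]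

theorem expectation_apply (ρ : Op D) (X : ∀ v, Matrix (D v) (D v) ℂ) :
    expectation ρ X = (ρ * tensorOp X).trace := rfl

variable [∀ v, DecidableEq (D v)]

/-- The family `X`, made trivial at the parties outside `C`. -/
def restrictObs (C : Finset V) (X : ∀ v, Matrix (D v) (D v) ℂ) : ∀ v, Matrix (D v) (D v) ℂ :=
  fun v => if v ∈ C then X v else 1

theorem restrictObs_congr {C : Finset V} {X Y : ∀ v, Matrix (D v) (D v) ℂ}
    (h : ∀ v ∈ C, X v = Y v) : restrictObs C X = restrictObs C Y := by
  ext1 v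
  by_cases hv : v ∈ C <;> simp [restrictObs, hv, h]

/-- The parties in `A` are uncorrelated with those in `B`. -/
def Uncorrelated (ρ : Op D) (A B : Finset V) : Prop :=
  ∀ X, expectation ρ (restrictObs (A ∪ B) X) =
    expectation ρ (restrictObs A X) * expectation ρ (restrictObs B X)

/-- Apply the hypothesis to an observable already trivial outside `A ∪ B`. Disjointness of `A'` and
`B'` keeps the factors at `B` out of the restriction to `A'`, and vice versa. -/
theorem Uncorrelated.mono {ρ : Op D} {A B A' B' : Finset V} (h : Uncorrelated ρ A' B')
    (hA : A ⊆ A') (hB : B ⊆ B') (hd : Disjoint A' B') : Uncorrelated ρ A B := by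
  intro X
  have hdis : ∀ v, v ∈ A' → v ∉ B' := fun v hv => Finset.disjoint_left.1 hd hv
  have h0 := h (restrictObs (A ∪ B) X)
  have e1 : restrictObs (A' ∪ B') (restrictObs (A ∪ B) X) = restrictObs (A ∪ B) X := by
    ext1 v
    simp only [restrictObs, Finset.mem_union]
    have := @hA v
    have := @hB v
    split_ifs <;> tauto
  have e2 : restrictObs A' (restrictObs (A ∪ B) X) = restrictObs A X := by
    ext1 v
    simp only [restrictObs, Finset.mem_union]
    have := @hA v
    have := @hB v
    have := hdis v
    split_ifs <;> tauto
  have e3 : restrictObs B' (restrictObs (A ∪ B) X) = restrictObs B X := by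
    ext1 v
    simp only [restrictObs, Finset.mem_union]
    have := @hA v
    have := @hB v
    have := hdis v
    split_ifs <;> tauto
  rwa [e1, e2, e3] at h0

end Tensor

/-! ### The light cone of a single step -/

section Steps

variable {V : Type u} [Fintype V] [DecidableEq V] {G : SimpleGraph V} {D D' : V → Type u}
  [∀ v, Fintype (D v)] [∀ v, DecidableEq (D v)] [∀ v, Fintype (D' v)] [∀ v, DecidableEq (D' v)]

namespace Step

theorem kraus_congr (s : Step G D D') {v : V} {m m' : ∀ v, s.out v} (h : m v = m' v)
    (h' : ∀ w, s.sends w v → m w = m' w) :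
    s.kraus v (m v) (fun w _ => m w) = s.kraus v (m' v) (fun w _ => m' w) := by
  rw [h]
  congr 1
  funext w hw
  exact h' w hw

/-- The rescaled Heisenberg evolution of the observable `X v`, given the list of outcomes. -/
noncomputable def pullback (s : Step G D D') (X : ∀ v, Matrix (D' v) (D' v) ℂ)
    (m : ∀ v, s.out v) (v : V) : Matrix (D v) (D v) ℂ :=
  (Fintype.card (s.out v) : ℂ) • ((s.kraus v (m v) fun w _ => m w).conjTranspose * X v *
    s.kraus v (m v) fun w _ => m w)

theorem pullback_congr (s : Step G D D') {X X' : ∀ v, Matrix (D' v) (D' v) ℂ} {v : V}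
    {m m' : ∀ v, s.out v} (hX : X v = X' v) (h : m v = m' v)
    (h' : ∀ w, s.sends w v → m w = m' w) : s.pullback X m v = s.pullback X' m' v := by
  rw [pullback, pullback, s.kraus_congr h h', hX]

open Classical in
/-- The parties which influence the outcome of a step at the parties in `C`. -/
noncomputable def past (s : Step G D D') (C : Finset V) : Finset V :=
  C ∪ Finset.univ.filter fun v => ∃ w ∈ C, s.sends v w

theorem mem_past {s : Step G D D'} {C : Finset V} {v : V} :
    v ∈ s.past C ↔ v ∈ C ∨ ∃ w ∈ C, s.sends v w := by
  simp [past]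

theorem past_union (s : Step G D D') (A B : Finset V) : s.past (A ∪ B) = s.past A ∪ s.past B := by
  ext v
  simp only [mem_past, Finset.mem_union]
  grind

/-- The factors `card (out v)` in `pullback` make the Heisenberg picture a uniform average over
outcomes, to which the independence of coordinates applies. -/
theorem card_mul_expectation_map (s : Step G D D') (ρ : Op D) (X : ∀ v, Matrix (D' v) (D' v) ℂ) :
    (Fintype.card (∀ v, s.out v) : ℂ) * expectation (s.map ρ) X =
      ∑ m, expectation ρ (s.pullback X m) := by
  have h : ∀ m, expectation ρ (s.pullback X m) = (Fintype.card (∀ v, s.out v) : ℂ) *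
      expectation ρ (fun v => (s.kraus v (m v) fun w _ => m w).conjTranspose * X v *
        s.kraus v (m v) fun w _ => m w) := by
    intro m
    unfold pullback
    rw [MultilinearMap.map_smul_univ, smul_eq_mul, Fintype.card_pi]
    push_cast
    rfl
  simp only [h, ← Finset.mul_sum]
  congr 1
  rw [expectation_apply, map, Finset.sum_mul, Matrix.trace_sum]
  refine Finset.sum_congr rfl fun m _ => ?_
  rw [expectation_apply, ← tensorOp_mul, ← tensorOp_mul, conjTranspose_tensorOp, Matrix.mul_assoc,
    Matrix.mul_assoc, Matrix.trace_mul_comm]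
  simp only [Matrix.mul_assoc]

theorem sum_pullback_update (s : Step G D D') {X : ∀ v, Matrix (D' v) (D' v) ℂ} {v : V}
    (hX : X v = 1) (m : ∀ v, s.out v) :
    ∑ c, s.pullback X (Function.update m v c) v = (Fintype.card (s.out v) : ℂ) • 1 := by
  unfold pullback
  rw [← Finset.smul_sum, ← s.complete v fun w _ => m w, hX]
  congr 1
  refine Finset.sum_congr rfl fun c _ => ?_
  have : (fun w (_ : s.sends w v) => Function.update m v c w) = fun w _ => m w := by
    funext w hw
    exact Function.update_of_ne (s.adj _ _ hw).ne _ _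
  rw [this, Function.update_self, Matrix.mul_one]

/-- Outside `C` the observable is 1, so completeness removes a party's factor once its outcome
influences no other factor. This takes two rounds: first the parties outside `C` that send nothing,
then the others outside the past. The receivers of the latter lie outside `C` and, by `not_both`,
send nothing, so their factors are already trivial. -/
theorem sum_expectation_pullback (s : Step G D D') (ρ : Op D) (C : Finset V)
    (X : ∀ v, Matrix (D' v) (D' v) ℂ) :
    ∑ m, expectation ρ (s.pullback (restrictObs C X) m) =
      ∑ m, expectation ρ (restrictObs (s.past C) (s.pullback (restrictObs C X) m)) := by
  classical
  have hX : ∀ v, v ∉ C → restrictObs C X v = 1 := fun v hv => by simp [restrictObs, hv]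
  rw [sum_multilinear_eq_of_average (expectation ρ) (fun _ => 1)
    (Finset.univ.filter fun v => v ∉ C ∧ ∀ w, ¬ s.sends v w),
    sum_multilinear_eq_of_average (expectation ρ) (fun _ => 1) (s.past C)ᶜ]
  · refine Finset.sum_congr rfl fun m _ => congrArg _ ?_
    ext1 v
    simp only [restrictObs, Finset.mem_compl, mem_past, Finset.mem_filter_univ]
    grind
  · intro v hv w hw m c
    simp only [Finset.mem_compl, mem_past, not_or, not_exists, not_and] at hv
    simp only [Finset.mem_filter_univ]
    split_ifs with h
    · rfl
    · refine s.pullback_congr rfl (Function.update_of_ne hw _ _) fun x hx =>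
        Function.update_of_ne ?_ _ _
      rintro rfl
      refine h ⟨fun hwC => hv.2 w hwC hx, fun y hy => s.not_both _ _ _ hx hy⟩
  · intro v hv m
    simp only [Finset.mem_compl, mem_past, not_or, not_exists, not_and] at hv
    simp only [Finset.mem_filter_univ]
    split_ifs with h
    · simp [← Nat.cast_smul_eq_nsmul ℂ]
    · exact s.sum_pullback_update (hX v hv.1) m
  · intro v hv w hw m c
    rw [Finset.mem_filter_univ] at hv
    refine s.pullback_congr rfl (Function.update_of_ne hw _ _) fun x hx =>
      Function.update_of_ne ?_ _ _
    rintro rfl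
    exact hv.2 w hx
  · intro v hv m
    rw [Finset.mem_filter_univ] at hv
    exact s.sum_pullback_update (hX v hv.1) m

theorem card_out_ne_zero (s : Step G D D') : (Fintype.card (∀ v, s.out v) : ℂ) ≠ 0 := by
  exact_mod_cast Fintype.card_ne_zero

theorem trace_map (s : Step G D D') (ρ : Op D) : (s.map ρ).trace = ρ.trace := by
  have h := s.card_mul_expectation_map ρ (restrictObs ∅ fun _ => 1)
  rw [sum_expectation_pullback] at h
  have h0 : s.past ∅ = ∅ := by ext v; simp [mem_past]
  have h1 : ∀ {D : V → Type u} [∀ v, Fintype (D v)] [∀ v, DecidableEq (D v)] (ρ : Op D)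
      (X : ∀ v, Matrix (D v) (D v) ℂ), expectation ρ (restrictObs ∅ X) = ρ.trace := by
    intro D _ _ ρ X
    have : restrictObs ∅ X = fun _ => 1 := by ext1 v; simp [restrictObs]
    rw [this, expectation_apply, tensorOp_one, mul_one]
  simp only [h0, h1, Finset.sum_const, Finset.card_univ, nsmul_eq_mul] at h
  exact mul_left_cancel₀ s.card_out_ne_zero h

theorem isDensity_map (s : Step G D D') {ρ : Op D} (h : IsDensity ρ) : IsDensity (s.map ρ) :=
  ⟨Matrix.posSemidef_sum _ fun _ _ => h.1.mul_mul_conjTranspose_same _,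
    by rw [trace_map, h.2]⟩

theorem uncorrelated_map (s : Step G D D') {ρ : Op D} {A B : Finset V}
    (hd : Disjoint (s.past A) (s.past B)) (h : Uncorrelated ρ (s.past A) (s.past B)) :
    Uncorrelated (s.map ρ) A B := by
  classical
  intro X
  have hA : ∀ v ∈ A, v ∈ s.past A := fun v hv => mem_past.2 (Or.inl hv)
  have hB : ∀ v ∈ B, v ∈ s.past B := fun v hv => mem_past.2 (Or.inl hv)
  have hdis : ∀ v, v ∈ s.past A → v ∉ s.past B := fun v hv => Finset.disjoint_left.1 hd hv
  have key : ∀ m, expectation ρ (restrictObs (s.past (A ∪ B))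
      (s.pullback (restrictObs (A ∪ B) X) m)) =
      expectation ρ (restrictObs (s.past A) (s.pullback (restrictObs A X) m)) *
        expectation ρ (restrictObs (s.past B) (s.pullback (restrictObs B X) m)) := by
    intro m
    rw [past_union, h]
    congr 2
    · refine restrictObs_congr fun v hv => s.pullback_congr ?_ rfl fun _ _ => rfl
      have : v ∉ B := fun hvB => hdis v hv (hB v hvB)
      simp [restrictObs, this]
    · refine restrictObs_congr fun v hv => s.pullback_congr ?_ rfl fun _ _ => rfl
      have : v ∉ A := fun hvA => hdis v (hA v hvA) hv
      simp [restrictObs, this]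
  -- A party of `C` hears only from the past of `C`; a party that sends to `C` hears from nobody. So
  -- the past needs no second enlargement.
  have local_dep : ∀ (C : Finset V) (m m' : ∀ v, s.out v), (∀ v ∈ s.past C, m v = m' v) →
      expectation ρ (restrictObs (s.past C) (s.pullback (restrictObs C X) m)) =
        expectation ρ (restrictObs (s.past C) (s.pullback (restrictObs C X) m')) := by
    intro C m m' hm
    congr 1
    refine restrictObs_congr fun v hv => s.pullback_congr rfl (hm v hv) fun w hw => ?_
    rcases mem_past.1 hv with hvC | ⟨x, -, hx⟩
    · exact hm w (mem_past.2 (Or.inr ⟨v, hvC, hw⟩))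
    · exact absurd hx (s.not_both _ _ _ hw)
  have hfac := card_mul_sum_mul_eq_sum_mul_sum (· ∈ s.past A)
    (fun m => expectation ρ (restrictObs (s.past A) (s.pullback (restrictObs A X) m)))
    (fun m => expectation ρ (restrictObs (s.past B) (s.pullback (restrictObs B X) m)))
    (local_dep A) fun m m' hm => local_dep B m m' fun v hv => hm v fun hvA => hdis v hvA hv
  simp only [← key] at hfac
  rw [← sum_expectation_pullback, ← sum_expectation_pullback, ← sum_expectation_pullback,
    ← card_mul_expectation_map, ← card_mul_expectation_map, ← card_mul_expectation_map] at hfac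
  -- Each of the three expectations carries one normalising factor and the independence identity
  -- another: two on either side.
  apply mul_left_cancel₀ s.card_out_ne_zero
  apply mul_left_cancel₀ s.card_out_ne_zero
  rw [hfac]
  ring

end Step
end Steps
-- The light cone of a protocol
section Propagation

variable {V : Type u} [Fintype V] [DecidableEq V] {G : SimpleGraph V}

/-- The parties in `C` and their neighbours. -/
def thicken (G : SimpleGraph V) [DecidableRel G.Adj] (C : Finset V) : Finset V :=
  C ∪ Finset.univ.filter fun v => ∃ w ∈ C, G.Adj v w

theorem mem_thicken [DecidableRel G.Adj] {C : Finset V} {v : V} :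
    v ∈ thicken G C ↔ v ∈ C ∨ ∃ w ∈ C, G.Adj v w := by
  simp [thicken]

theorem subset_iterate_thicken [DecidableRel G.Adj] (k : ℕ) (C : Finset V) :
    C ⊆ (thicken G)^[k] C := by
  induction k generalizing C with
  | zero => simp
  | succ k ih => exact fun v hv => ih (thicken G C) (mem_thicken.2 (Or.inl hv))

theorem exists_walk_of_mem_iterate_thicken [DecidableRel G.Adj] {k : ℕ} {a v : V}
    (h : v ∈ (thicken G)^[k] {a}) : ∃ p : G.Walk a v, p.length ≤ k := by
  induction k generalizing v with
  | zero =>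
    obtain rfl : v = a := by simpa using h
    exact ⟨.nil, le_rfl⟩
  | succ k ih =>
    rw [Function.iterate_succ_apply', mem_thicken] at h
    rcases h with h | ⟨w, hw, hvw⟩
    · obtain ⟨p, hp⟩ := ih h
      exact ⟨p, hp.trans k.le_succ⟩
    · obtain ⟨p, hp⟩ := ih hw
      exact ⟨p.concat hvw.symm, by simpa using hp⟩

variable {D D' : V → Type u} [∀ v, Fintype (D v)] [∀ v, DecidableEq (D v)] [∀ v, Fintype (D' v)]
  [∀ v, DecidableEq (D' v)]

theorem Step.past_subset_thicken [DecidableRel G.Adj] (s : Step G D D') (C : Finset V) :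
    s.past C ⊆ thicken G C := by
  intro v hv
  rcases mem_past.1 hv with hv | ⟨w, hw, hvw⟩
  · exact mem_thicken.2 (Or.inl hv)
  · exact mem_thicken.2 (Or.inr ⟨w, hw, s.adj _ _ hvw⟩)

theorem IsLOCC.isDensity {k : ℕ} {Λ : Op D → Op D'} (h : IsLOCC G D k D' Λ) {ρ : Op D}
    (hρ : IsDensity ρ) : IsDensity (Λ ρ) := by
  induction h with
  | refl => exact hρ
  | localOp s _ _ ih => exact s.isDensity_map ih
  | step s _ ih => exact s.isDensity_map ih

/-- The induction peels off the last step, whose past lies in `thicken G A`; the other `k`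
thickenings are applied to that set. Local operations do not enlarge the past. -/
theorem IsLOCC.uncorrelated [DecidableRel G.Adj] {k : ℕ} {Λ : Op D → Op D'}
    (h : IsLOCC G D k D' Λ) {ρ : Op D} {A B : Finset V}
    (hd : Disjoint ((thicken G)^[k] A) ((thicken G)^[k] B))
    (hρ : Uncorrelated ρ ((thicken G)^[k] A) ((thicken G)^[k] B)) : Uncorrelated (Λ ρ) A B := by
  induction h generalizing A B with
  | refl => exact hρ
  | localOp s hs _ ih =>
    have hpast : ∀ C, s.past C = C := fun C => by
      ext v
      simp [Step.mem_past, hs]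
    refine s.uncorrelated_map ?_ ?_
    · rw [hpast, hpast]
      exact hd.mono (subset_iterate_thicken _ _) (subset_iterate_thicken _ _)
    · rw [hpast, hpast]
      exact ih hd hρ
  | @step k _ _ _ _ _ _ _ s _ ih =>
    have hd' : Disjoint (thicken G A) (thicken G B) :=
      hd.mono (subset_iterate_thicken k _) (subset_iterate_thicken k _)
    refine s.uncorrelated_map (hd'.mono (s.past_subset_thicken A) (s.past_subset_thicken B)) ?_
    exact (ih hd hρ).mono (s.past_subset_thicken A) (s.past_subset_thicken B) hd'

end Propagation

/-! ### Correlations in a network of bipartite sources -/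

section Sources

variable {V : Type u} [Fintype V] [DecidableEq V] {G : SimpleGraph V} [DecidableRel G.Adj]

/-- Grouping the particles of a `G`-state by source instead of by party. -/
def GState.regroup (σ : GState G) :
    (∀ v, σ.Local v) ≃ ∀ e : G.edgeSet, ∀ v : {v // v ∈ e.1}, σ.S e v where
  toFun i e v := i v.1 ⟨e, v.2⟩
  invFun j v e := j e.1 ⟨v, e.2⟩

theorem prod_incidence_comm (f : V → G.edgeSet → ℂ) :
    ∏ v, ∏ e : {e : G.edgeSet // v ∈ e.1}, f v e =
      ∏ e : G.edgeSet, ∏ v : {v // v ∈ e.1}, f v e := by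
  have h1 : ∀ v, ∏ e : {e : G.edgeSet // v ∈ e.1}, f v e =
      ∏ e : G.edgeSet, if v ∈ e.1 then f v e else 1 := fun v => by
    rw [← Finset.prod_filter]
    exact (Finset.prod_subtype _ (by simp) _).symm
  have h2 : ∀ e : G.edgeSet, ∏ v : {v // v ∈ e.1}, f v e =
      ∏ v, if v ∈ e.1 then f v e else 1 := fun e => by
    rw [← Finset.prod_filter]
    exact (Finset.prod_subtype (p := fun v => v ∈ e.1) (Finset.univ.filter fun v => v ∈ e.1)
      (fun v => by rw [Finset.mem_filter_univ]) fun v => f v e).symm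
  simp only [h1, h2]
  exact Finset.prod_comm

theorem GState.expectation_state (σ : GState G)
    (x : ∀ v, ∀ e : {e : G.edgeSet // v ∈ e.1}, Matrix (σ.S e.1 v) (σ.S e.1 v) ℂ) :
    expectation σ.state (fun v => tensorOp (x v)) =
      ∏ e : G.edgeSet, (σ.γ e * tensorOp fun v : {v // v ∈ e.1} => x v ⟨e, v.2⟩).trace := by
  have hprod : ∀ i j : ∀ v, σ.Local v, ∏ v, ∏ e : {e : G.edgeSet // v ∈ e.1},
      x v e (i v e) (j v e) = ∏ e : G.edgeSet, ∏ v : {v // v ∈ e.1},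
        x v ⟨e, v.2⟩ (σ.regroup i e v) (σ.regroup j e v) := by
    intro i j
    convert prod_incidence_comm (G := G) fun v e =>
      if h : v ∈ e.1 then x v ⟨e, h⟩ (i v ⟨e, h⟩) (j v ⟨e, h⟩) else 1 using 4 with v _ e _ e _ v _
    · simp [e.2]
    · simp [v.2, GState.regroup]
  simp only [expectation_apply, Matrix.trace, Matrix.diag, Matrix.mul_apply, GState.state,
    tensorOp, Matrix.of_apply]
  simp_rw [hprod]
  rw [Finset.prod_univ_sum, Fintype.piFinset_univ, ← σ.regroup.sum_comp]
  refine Finset.sum_congr rfl fun i _ => ?_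
  rw [Finset.prod_univ_sum, Fintype.piFinset_univ, ← σ.regroup.sum_comp]
  refine Finset.sum_congr rfl fun j _ => ?_
  rw [← Finset.prod_mul_distrib]
  rfl

theorem GState.isDensity_state (σ : GState G) : IsDensity σ.state := by
  constructor
  · have h : ∀ t : Finset G.edgeSet, (Matrix.of fun i j : ∀ v, σ.Local v => ∏ e ∈ t,
        σ.γ e (fun v => i v.1 ⟨e, v.2⟩) (fun v => j v.1 ⟨e, v.2⟩)).PosSemidef := by
      intro t
      induction t using Finset.induction_on with
      | empty =>
        convert Matrix.posSemidef_vecMulVec_self_star (fun _ : (∀ v, σ.Local v) => (1 : ℂ))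
        ext i j
        simp [Matrix.vecMulVec_apply]
      | insert e t he ih =>
        -- Seen as a matrix over all indices, each source is a positive semidefinite pullback, and
        -- the joint state is their entrywise product: Schur's product theorem.
        have h := ((σ.density e).1.submatrix
          fun (i : ∀ v, σ.Local v) (v : {v // v ∈ e.1}) => i v.1 ⟨e, v.2⟩).hadamard ih
        refine (congrArg Matrix.PosSemidef ?_).mp h
        ext i j
        simp [Finset.prod_insert he]
    exact h Finset.univ
  · have h := σ.expectation_state fun _ _ => 1
    simp only [tensorOp_one, mul_one, (σ.density _).2, Finset.prod_const_one] at h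
    rw [← h, expectation_apply, tensorOp_one, mul_one]

theorem tensorOp_single {W : Type u} [Fintype W] {D : W → Type u} [∀ v, DecidableEq (D v)]
    [DecidableEq (∀ v, D v)] (i j : ∀ v, D v) :
    tensorOp (fun v => Matrix.single (i v) (j v) (1 : ℂ)) = Matrix.single i j 1 := by
  ext k l
  simp only [tensorOp, Matrix.of_apply, Matrix.single_apply]
  rw [Fintype.prod_ite_zero]
  simp only [funext_iff, forall_and, Finset.prod_const_one]

theorem restrictObs_update_of_mem {D : V → Type u} [∀ v, Fintype (D v)] [∀ v, DecidableEq (D v)]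
    {C : Finset V} {v : V} (hv : v ∈ C) (X : ∀ v, Matrix (D v) (D v) ℂ) (Y : Matrix (D v) (D v) ℂ) :
    restrictObs C (Function.update X v Y) = Function.update (restrictObs C X) v Y := by
  ext1 w
  by_cases h : w = v
  · subst h; simp [restrictObs, hv]
  · simp [restrictObs, h]

theorem restrictObs_update_of_notMem {D : V → Type u} [∀ v, Fintype (D v)]
    [∀ v, DecidableEq (D v)] {C : Finset V} {v : V} (hv : v ∉ C)
    (X : ∀ v, Matrix (D v) (D v) ℂ) (Y : Matrix (D v) (D v) ℂ) :
    restrictObs C (Function.update X v Y) = restrictObs C X := by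
  refine restrictObs_congr fun w hw => Function.update_of_ne ?_ _ _
  rintro rfl
  exact hv hw

/-- In a `G`-state, sets of parties without a common source are uncorrelated. -/
theorem GState.uncorrelated_state (σ : GState G) {A B : Finset V} (hd : Disjoint A B)
    (hAB : ∀ u ∈ A, ∀ v ∈ B, ¬ G.Adj u v) : Uncorrelated σ.state A B := by
  classical
  have hdis : ∀ v, v ∈ A → v ∉ B := fun v hv => Finset.disjoint_left.1 hd hv
  have hprod : ∀ x : ∀ v, ∀ e : {e : G.edgeSet // v ∈ e.1}, Matrix (σ.S e.1 v) (σ.S e.1 v) ℂ,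
      expectation σ.state (restrictObs (A ∪ B) fun v => tensorOp (x v)) =
        expectation σ.state (restrictObs A fun v => tensorOp (x v)) *
          expectation σ.state (restrictObs B fun v => tensorOp (x v)) := by
    intro x
    have hres : ∀ C : Finset V, restrictObs C (fun v => tensorOp (x v)) =
        fun v => tensorOp (if v ∈ C then x v else fun _ => 1) := by
      intro C
      ext1 v
      by_cases hv : v ∈ C <;> simp [restrictObs, hv, tensorOp_one]
    rw [hres, hres, hres, expectation_state, expectation_state, expectation_state,
      ← Finset.prod_mul_distrib]
    refine Finset.prod_congr rfl fun e _ => ?_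
    have htriv : ∀ C : Finset V, (∀ v : {v // v ∈ e.1}, v.1 ∉ C) →
        (σ.γ e * tensorOp fun v : {v // v ∈ e.1} =>
          (if v.1 ∈ C then x v.1 else fun _ => 1) ⟨e, v.2⟩).trace = 1 := by
      intro C hC
      simp only [hC, if_false, tensorOp_one, mul_one, (σ.density e).2]
    by_cases hA : ∀ v : {v // v ∈ e.1}, v.1 ∉ A
    · rw [htriv A hA, one_mul]
      simp [hA]
    · have hB : ∀ v : {v // v ∈ e.1}, v.1 ∉ B := by
        push Not at hA
        obtain ⟨⟨u, hu⟩, huA⟩ := hA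
        rintro ⟨v, hv⟩ hvB
        have huv : u ≠ v := by
          rintro rfl
          exact hdis u huA hvB
        refine hAB u huA v hvB ?_
        rw [← SimpleGraph.mem_edgeSet, ← (Sym2.mem_and_mem_iff huv).1 ⟨hu, hv⟩]
        exact e.2
      rw [htriv B hB, mul_one]
      simp [hB]
  -- Pass from observables that factor over the particles to arbitrary ones, one party of `U` at a
  -- time: both sides are linear in `X v`, and the matrix units of a party's system factor over its
  -- particles.
  have hgen : ∀ (U : Finset V) (X : ∀ v, Matrix (σ.Local v) (σ.Local v) ℂ),
      (∀ v ∉ U, ∃ x : ∀ e : {e : G.edgeSet // v ∈ e.1}, Matrix (σ.S e.1 v) (σ.S e.1 v) ℂ,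
        X v = tensorOp x) →
      expectation σ.state (restrictObs (A ∪ B) X) =
        expectation σ.state (restrictObs A X) * expectation σ.state (restrictObs B X) := by
    intro U
    induction U using Finset.induction_on with
    | empty =>
      intro X hX
      choose x hx using fun v => hX v (Finset.notMem_empty v)
      rw [show X = fun v => tensorOp (x v) from funext hx]
      exact hprod x
    | insert v U hv ih =>
      intro X hX
      have hupd : ∀ x : ∀ e : {e : G.edgeSet // v ∈ e.1}, Matrix (σ.S e.1 v) (σ.S e.1 v) ℂ,
          ∀ w ∉ U, ∃ y : ∀ e : {e : G.edgeSet // w ∈ e.1}, Matrix (σ.S e.1 w) (σ.S e.1 w) ℂ,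
            Function.update X v (tensorOp x) w = tensorOp y := by
        intro x w hw
        by_cases hwv : w = v
        · subst hwv
          exact ⟨x, by simp⟩
        · obtain ⟨y, hy⟩ := hX w (by simp [hwv, hw])
          exact ⟨y, by simp [hwv, hy]⟩
      by_cases hA : v ∈ A
      · have hB := hdis v hA
        have hlin : (expectation σ.state).toLinearMap (restrictObs (A ∪ B) X) v =
            expectation σ.state (restrictObs B X) •
              (expectation σ.state).toLinearMap (restrictObs A X) v := by
          refine Matrix.ext_linearMap ℂ fun i j => LinearMap.ext_ring ?_
          have := ih _ (hupd fun e => Matrix.single (i e) (j e) 1)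
          rw [restrictObs_update_of_mem (by simp [hA]), restrictObs_update_of_mem hA,
            restrictObs_update_of_notMem hB, tensorOp_single, mul_comm] at this
          exact this
        have := LinearMap.congr_fun hlin (X v)
        rw [LinearMap.smul_apply, MultilinearMap.toLinearMap_apply,
          MultilinearMap.toLinearMap_apply, ← restrictObs_update_of_mem (by simp [hA]),
          ← restrictObs_update_of_mem hA, Function.update_eq_self] at this
        rw [this, smul_eq_mul, mul_comm]
      · by_cases hB : v ∈ B
        · have hlin : (expectation σ.state).toLinearMap (restrictObs (A ∪ B) X) v =
              expectation σ.state (restrictObs A X) •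
                (expectation σ.state).toLinearMap (restrictObs B X) v := by
            refine Matrix.ext_linearMap ℂ fun i j => LinearMap.ext_ring ?_
            have := ih _ (hupd fun e => Matrix.single (i e) (j e) 1)
            rw [restrictObs_update_of_mem (by simp [hB]), restrictObs_update_of_mem hB,
              restrictObs_update_of_notMem hA, tensorOp_single] at this
            exact this
          have := LinearMap.congr_fun hlin (X v)
          rw [LinearMap.smul_apply, MultilinearMap.toLinearMap_apply,
            MultilinearMap.toLinearMap_apply, ← restrictObs_update_of_mem (by simp [hB]),
            ← restrictObs_update_of_mem hB, Function.update_eq_self] at this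
          rw [this, smul_eq_mul]
        · have := ih _ (hupd fun _ => 1)
          rwa [restrictObs_update_of_notMem (by simp [hA, hB]), restrictObs_update_of_notMem hA,
            restrictObs_update_of_notMem hB] at this
  exact fun X => hgen Finset.univ X fun v hv => absurd (Finset.mem_univ v) hv

end Sources

/-! ### Reduced states as expectations of matrix units -/

section Marginals

variable {V : Type u} [Fintype V] [DecidableEq V] {D : V → Type u} [∀ v, Fintype (D v)]
  [∀ v, DecidableEq (D v)]

/-- The reduced state of the party `a`. -/
noncomputable def marginal (ρ : Op D) (a : V) : Matrix (D a) (D a) ℂ :=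
  -- The coordinate `i a` is overwritten, so each index of the other parties is counted `card (D a)`
  -- times.
  (Fintype.card (D a) : ℝ)⁻¹ • ∑ i : (∀ v, D v),
    ρ.submatrix (Function.update i a) (Function.update i a)

theorem posSemidef_marginal {ρ : Op D} (hρ : ρ.PosSemidef) (a : V) :
    (marginal ρ a).PosSemidef :=
  (Matrix.posSemidef_sum _ fun _ _ => hρ.submatrix _).smul (by positivity)

/-- For products of matrix units and identities, each row index `i` meets at most one `j = f i` with
a nonzero entry. -/
theorem expectation_eq_sum_ite {ρ : Op D} {X : ∀ v, Matrix (D v) (D v) ℂ} {q : (∀ v, D v) → Prop}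
    [DecidablePred q] {f : (∀ v, D v) → ∀ v, D v}
    (h : ∀ i j, (∀ v, X v (j v) (i v) ≠ 0) → q i ∧ j = f i)
    (h1 : ∀ i, q i → ∀ v, X v (f i v) (i v) = 1) :
    expectation ρ X = ∑ i, if q i then ρ i (f i) else 0 := by
  simp only [expectation_apply, Matrix.trace, Matrix.diag, Matrix.mul_apply, tensorOp,
    Matrix.of_apply]
  refine Finset.sum_congr rfl fun i _ => ?_
  have hz : ∀ j, ¬ (q i ∧ j = f i) → ∏ v, X v (j v) (i v) = 0 := by
    intro j hj
    by_contra hne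
    exact hj (h i j fun v => (Finset.prod_ne_zero_iff.1 hne) v (Finset.mem_univ v))
  split_ifs with hq
  · rw [Finset.sum_eq_single (f i)]
    · simp [h1 i hq]
    · intro j _ hj
      rw [hz j fun hh => hj hh.2, mul_zero]
    · simp
  · exact Finset.sum_eq_zero fun j _ => by rw [hz j fun hh => hq hh.1, mul_zero]

theorem marginal_apply (ρ : Op D) (a : V) (x y : D a) :
    marginal ρ a x y =
      expectation ρ (Function.update (fun _ => 1) a (Matrix.single y x 1)) := by
  have : Nonempty (D a) := ⟨x⟩
  have hc : (Fintype.card (D a) : ℂ) ≠ 0 := by exact_mod_cast Fintype.card_ne_zero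
  rw [expectation_eq_sum_ite (q := fun i => i a = x) (f := fun i => Function.update i a y)]
  · apply mul_left_cancel₀ hc
    rw [← nsmul_eq_mul (Fintype.card (D a)) (∑ i : (∀ v, D v), _), ← sum_sum_update _ a, marginal]
    simp only [Matrix.smul_apply, Matrix.sum_apply, Matrix.submatrix_apply, Function.update_self,
      Function.update_idem, Finset.sum_ite_eq', Finset.mem_univ, if_true, Complex.real_smul]
    push_cast
    rw [mul_inv_cancel_left₀ hc]
  · intro i j hij
    have ha := hij a
    rw [Function.update_self, Matrix.single_apply] at ha
    have ha' : y = j a ∧ x = i a := by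
      by_contra hne
      exact ha (if_neg hne)
    refine ⟨ha'.2.symm, funext fun v => ?_⟩
    by_cases hv : v = a
    · subst hv; simp [ha'.1]
    · have := hij v
      rw [Function.update_of_ne hv, Matrix.one_apply, Ne, ite_eq_right_iff] at this
      rw [Function.update_of_ne hv]
      by_contra hne
      exact this fun h => absurd h hne
  · intro i hi v
    by_cases hv : v = a
    · subst hv; simp [hi]
    · simp [hv]

theorem isDensity_marginal {ρ : Op D} (hρ : IsDensity ρ) (a : V) : IsDensity (marginal ρ a) := by
  refine ⟨posSemidef_marginal hρ.1 a, ?_⟩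
  simp only [Matrix.trace, Matrix.diag, marginal_apply]
  rw [← MultilinearMap.map_update_sum]
  have : ∑ x : D a, Matrix.single x x (1 : ℂ) = 1 := by
    ext i j
    simp [Matrix.sum_apply, Matrix.single_apply, Matrix.one_apply, ite_and]
  rw [this, Function.update_eq_self a (fun v => (1 : Matrix (D v) (D v) ℂ)), expectation_apply,
    tensorOp_one, mul_one, hρ.2]

theorem reducedPair_apply (ρ : Op D) {a b : V} (hab : a ≠ b) (x y : D a × D b) :
    reducedPair ρ a b x y = expectation ρ (Function.update (Function.update (fun _ => 1) a
      (Matrix.single y.1 x.1 1)) b (Matrix.single y.2 x.2 1)) := by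
  rw [expectation_eq_sum_ite (q := fun i => i a = x.1 ∧ i b = x.2)
    (f := fun i => Function.update (Function.update i a y.1) b y.2)]
  · rfl
  · intro i j hij
    have hb := hij b
    rw [Function.update_self, Matrix.single_apply] at hb
    have hb' : y.2 = j b ∧ x.2 = i b := by
      by_contra hne
      exact hb (if_neg hne)
    have ha := hij a
    rw [Function.update_of_ne hab, Function.update_self, Matrix.single_apply] at ha
    have ha' : y.1 = j a ∧ x.1 = i a := by
      by_contra hne
      exact ha (if_neg hne)
    refine ⟨⟨ha'.2.symm, hb'.2.symm⟩, funext fun v => ?_⟩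
    by_cases hvb : v = b
    · subst hvb; simp [hb'.1]
    · by_cases hv : v = a
      · subst hv; simp [ha'.1, hvb]
      · have := hij v
        rw [Function.update_of_ne hvb, Function.update_of_ne hv, Matrix.one_apply, Ne,
          ite_eq_right_iff] at this
        rw [Function.update_of_ne hvb, Function.update_of_ne hv]
        by_contra hne
        exact this fun h => absurd h hne
  · rintro i ⟨hia, hib⟩ v
    by_cases hvb : v = b
    · subst hvb; simp [hib]
    · by_cases hv : v = a
      · subst hv; simp [hia, hvb]
      · simp [hv, hvb]

theorem Uncorrelated.reducedPair_eq {ρ : Op D} {a b : V} (hab : a ≠ b)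
    (h : Uncorrelated ρ {a} {b}) :
    reducedPair ρ a b = Matrix.kroneckerMap (· * ·) (marginal ρ a) (marginal ρ b) := by
  ext x y
  rw [Matrix.kroneckerMap_apply, marginal_apply, marginal_apply, reducedPair_apply ρ hab]
  have := h (Function.update (Function.update (fun _ => 1) a
      (Matrix.single y.1 x.1 1)) b (Matrix.single y.2 x.2 1))
  convert this using 2
  · ext1 v
    by_cases hvb : v = b
    · subst hvb; simp [restrictObs]
    · by_cases hv : v = a
      · subst hv; simp [restrictObs]
      · simp [restrictObs, hv, hvb]
  · congr 1
    ext1 v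
    by_cases hv : v = a
    · subst hv; simp [restrictObs, hab]
    · simp [restrictObs, hv]
  · congr 1
    ext1 v
    by_cases hv : v = b
    · subst hv; simp [restrictObs]
    · simp [restrictObs, hv]

end Marginals

/-! ### Few steps leave distant parties separable -/

section LowerBound

variable {V : Type u} [Fintype V] [DecidableEq V] {G : SimpleGraph V} [DecidableRel G.Adj]
  {D : V → Type u} [∀ v, Fintype (D v)] [∀ v, DecidableEq (D v)]

/-- A common vertex of the two `k`-balls would give a walk of length at most `2 * k`, an edge
between them one of at most `2 * k + 1`. So each value of the shared randomness gives a product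
state. -/
theorem isSeparable_reducedPair_of_mem_preparable {k : ℕ} {a b : V}
    (hab : ∀ p : G.Walk a b, 2 * k + 1 < p.length) {ρ : Op D} (hρ : ρ ∈ preparable G k) :
    IsSeparable (reducedPair ρ a b) := by
  have hne : a ≠ b := by
    rintro rfl
    simpa using hab .nil
  obtain ⟨σ, n, p, Λ, hp, hΛ, rfl⟩ := hρ
  refine ⟨n, p, fun i => marginal (Λ i σ.state) a, fun i => marginal (Λ i σ.state) b, hp,
    fun i => isDensity_marginal ((hΛ i).isDensity σ.isDensity_state) a,
    fun i => isDensity_marginal ((hΛ i).isDensity σ.isDensity_state) b, ?_⟩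
  have hd : Disjoint ((thicken G)^[k] {a}) ((thicken G)^[k] {b}) := by
    refine Finset.disjoint_left.2 fun v hva hvb => ?_
    obtain ⟨q, hq⟩ := exists_walk_of_mem_iterate_thicken hva
    obtain ⟨r, hr⟩ := exists_walk_of_mem_iterate_thicken hvb
    have := hab (q.append r.reverse)
    rw [SimpleGraph.Walk.length_append, SimpleGraph.Walk.length_reverse] at this
    omega
  have hunc : Uncorrelated σ.state ((thicken G)^[k] {a}) ((thicken G)^[k] {b}) := by
    refine σ.uncorrelated_state hd fun u hu v hv huv => ?_
    obtain ⟨q, hq⟩ := exists_walk_of_mem_iterate_thicken hu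
    obtain ⟨r, hr⟩ := exists_walk_of_mem_iterate_thicken hv
    have := hab ((q.concat huv).append r.reverse)
    rw [SimpleGraph.Walk.length_append, SimpleGraph.Walk.length_reverse,
      SimpleGraph.Walk.length_concat] at this
    omega
  have hsum : reducedPair (∑ i, (p i : ℝ) • Λ i σ.state) a b =
      ∑ i, (p i : ℝ) • reducedPair (Λ i σ.state) a b := by
    ext x y
    simp only [reducedPair_apply _ hne, Matrix.sum_apply, Matrix.smul_apply, expectation_apply,
      Finset.sum_mul, Matrix.trace_sum, Matrix.smul_mul, Matrix.trace_smul]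
  rw [hsum]
  exact Finset.sum_congr rfl fun i _ => by rw [((hΛ i).uncorrelated hd hunc).reducedPair_eq hne]

theorem isSeparable_reducedPair_of_mem_closure {k : ℕ} {a b : V}
    (hab : ∀ p : G.Walk a b, 2 * k + 1 < p.length) {ρ : Op D}
    (hρ : ρ ∈ closure (preparable G k)) : IsSeparable (reducedPair ρ a b) := by
  have hcont : Continuous fun ρ : Op D => reducedPair ρ a b := by
    refine continuous_matrix fun x y => ?_
    simp only [reducedPair, Matrix.of_apply]
    refine continuous_finsetSum _ fun i _ => ?_
    split_ifs
    · exact continuous_id.matrix_elem _ _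
    · exact continuous_const
  exact closure_minimal (fun ρ hρ => isSeparable_reducedPair_of_mem_preparable hab hρ)
    (isClosed_setOf_isSeparable.preimage hcont) hρ

end LowerBound

/-! ### Superpositions, monomial Kraus operators and branches -/

section Superposition

variable {I J Y : Type*} [DecidableEq I] [DecidableEq J] [Fintype Y]

/-- The superposition of the basis vectors `g y` with amplitudes `c y`. -/
def superposition (c : Y → ℂ) (g : Y → I) : I → ℂ := fun i => ∑ y, if i = g y then c y else 0

theorem superposition_congr {c c' : Y → ℂ} {g g' : Y → I} (hc : ∀ y, c y = c' y)
    (hg : ∀ y, c y ≠ 0 → g y = g' y) : superposition c g = superposition c' g' := by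
  ext i
  refine Finset.sum_congr rfl fun y _ => ?_
  rw [← hc]
  by_cases h : c y = 0
  · simp [h]
  · rw [hg y h]

theorem superposition_comp_equiv (c : Y → ℂ) (g : Y → I) (e : Y ≃ Y) :
    superposition (c ∘ e) (g ∘ e) = superposition c g := by
  ext i
  exact e.sum_comp fun y => if i = g y then c y else 0

theorem superposition_const_mul (a : ℂ) (c : Y → ℂ) (g : Y → I) :
    superposition (fun y => a * c y) g = a • superposition c g := by
  ext i
  simp [superposition, Finset.mul_sum]

theorem sum_norm_sq_superposition [Fintype I] (c : Y → ℂ) {g : Y → I} (hg : Function.Injective g) :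
    ∑ i, ‖superposition c g i‖ ^ 2 = ∑ y, ‖c y‖ ^ 2 := by
  classical
  rw [← Finset.sum_subset (Finset.subset_univ (Finset.univ.image g))]
  · rw [Finset.sum_image fun _ _ _ _ h => hg h]
    refine Finset.sum_congr rfl fun y _ => ?_
    simp [superposition, hg.eq_iff]
  · intro i _ hi
    have : superposition c g i = 0 := by
      refine Finset.sum_eq_zero fun y _ => if_neg ?_
      rintro rfl
      exact hi (Finset.mem_image_of_mem g (Finset.mem_univ y))
    simp [this]

/-- The operator that sends the basis vector `i` to `a i` times the basis vector `f i`. -/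
def monomialMatrix (f : I → J) (a : I → ℂ) : Matrix J I ℂ :=
  Matrix.of fun j i => if j = f i then a i else 0

theorem monomialMatrix_mulVec_superposition [Fintype I] (f : I → J) (a : I → ℂ) (c : Y → ℂ)
    (g : Y → I) : (monomialMatrix f a).mulVec (superposition c g) =
      superposition (fun y => c y * a (g y)) (fun y => f (g y)) := by
  ext j
  simp only [Matrix.mulVec, dotProduct, monomialMatrix, superposition, Matrix.of_apply,
    Finset.mul_sum]
  rw [Finset.sum_comm]
  refine Finset.sum_congr rfl fun y _ => ?_
  rw [Finset.sum_eq_single (g y)]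
  · simp only [if_true]
    split_ifs <;> ring
  · intro i _ hi
    simp [hi]
  · simp

theorem sum_conjTranspose_monomialMatrix_mul [Fintype I] [Fintype J] {M : Type*} [Fintype M]
    (f : I → J) (a : M → I → ℂ)
    (h : ∀ i j, f i = f j → ∑ m, star (a m i) * a m j = if i = j then 1 else 0) :
    ∑ m, (monomialMatrix f (a m)).conjTranspose * monomialMatrix f (a m) = 1 := by
  ext i j
  have h1 : ∀ m, ((monomialMatrix f (a m)).conjTranspose * monomialMatrix f (a m)) i j =
      if f i = f j then star (a m i) * a m j else 0 := by
    intro m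
    simp only [Matrix.mul_apply, Matrix.conjTranspose_apply, monomialMatrix, Matrix.of_apply]
    rw [Finset.sum_eq_single (f j)]
    · by_cases hij : f i = f j
      · simp [hij]
      · simp [hij, Ne.symm hij]
    · intro k _ hk
      simp [hk]
    · simp
  rw [Matrix.sum_apply]
  simp only [h1]
  by_cases hij : f i = f j
  · simp only [hij, if_true]
    rw [h i j hij, Matrix.one_apply]
  · have : i ≠ j := fun h => hij (congrArg f h)
    simp [hij, this]

theorem tensorOp_monomialMatrix {V : Type u} [Fintype V] [DecidableEq V] {D D' : V → Type u}
    [∀ v, DecidableEq (D v)] [∀ v, DecidableEq (D' v)] (f : ∀ v, D v → D' v)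
    (a : ∀ v, D v → ℂ) : tensorOp (fun v => monomialMatrix (f v) (a v)) =
      monomialMatrix (fun i v => f v (i v)) (fun i => ∏ v, a v (i v)) := by
  ext j i
  simp only [tensorOp, monomialMatrix, Matrix.of_apply]
  rw [Fintype.prod_ite_zero]
  simp [funext_iff]

end Superposition

section Branches

variable {V : Type u} [Fintype V] [DecidableEq V] {G : SimpleGraph V} {D D' : V → Type u}
  [∀ v, Fintype (D v)] [∀ v, DecidableEq (D v)] [∀ v, Fintype (D' v)] [∀ v, DecidableEq (D' v)]

/-- The scalar is left open, and may vanish in single branches: only the final one matters, and the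
trace determines it. -/
theorem Step.exists_map_eq_smul_vecMulVec (s : Step G D D') {Φ : (∀ v, D v) → ℂ}
    {Φ' : (∀ v, D' v) → ℂ}
    (h : ∀ m : ∀ v, s.out v, ∃ c : ℂ,
      (tensorOp fun v => s.kraus v (m v) fun w _ => m w).mulVec Φ = c • Φ') {ρ : Op D} {a : ℂ}
    (hρ : ρ = a • Matrix.vecMulVec Φ (star Φ)) :
    ∃ c : ℂ, s.map ρ = c • Matrix.vecMulVec Φ' (star Φ') := by
  choose c hc using h
  refine ⟨∑ m, a * (c m * star (c m)), ?_⟩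
  rw [Step.map, Finset.sum_smul]
  refine Finset.sum_congr rfl fun m _ => ?_
  rw [hρ, Matrix.mul_smul, Matrix.smul_mul, Matrix.mul_vecMulVec, Matrix.vecMulVec_mul,
    ← Matrix.star_mulVec, hc, star_smul, Matrix.smul_vecMulVec, Matrix.vecMulVec_smul, smul_smul,
    smul_smul, mul_assoc]

end Branches

/-! ### Routes from the root edge to all parties -/

/-- A rooted spanning forest of the graph: the roots are the two ends of the edge `root`. -/
structure Routing {V : Type u} (G : SimpleGraph V) where
  root : G.edgeSet
  depth : V → ℕ
  parent : V → V
  depth_eq_zero : ∀ v, depth v = 0 ↔ v ∈ root.1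
  adj : ∀ v, depth v ≠ 0 → G.Adj (parent v) v
  depth_parent : ∀ v, depth v ≠ 0 → depth (parent v) + 1 = depth v

namespace Routing

variable {V : Type u} {G : SimpleGraph V} (r : Routing G)

/-- The edge towards the root. -/
def inEdge (v : V) : G.edgeSet :=
  if h : r.depth v = 0 then r.root else ⟨s(r.parent v, v), r.adj v h⟩

/-- The last vertex of depth at most `t` on the way from the root to `w`. -/
def loc (t : ℕ) (w : V) : V := r.parent^[r.depth w - t] w

theorem inEdge_of_depth_eq_zero {v : V} (h : r.depth v = 0) : r.inEdge v = r.root := by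
  simp [inEdge, h]

theorem mem_inEdge_iff {v x : V} (h : r.depth v ≠ 0) :
    x ∈ (r.inEdge v).1 ↔ x = r.parent v ∨ x = v := by
  simp [inEdge, h]

theorem mem_inEdge (v : V) : v ∈ (r.inEdge v).1 := by
  by_cases h : r.depth v = 0
  · rw [inEdge_of_depth_eq_zero r h]
    exact (r.depth_eq_zero v).1 h
  · exact (r.mem_inEdge_iff h).2 (Or.inr rfl)

/-- A vertex of positive depth is the lower end of its edge: two vertices cannot be each other's
parent, by depth. -/
theorem inEdge_inj {u v : V} (hv : r.depth v ≠ 0) (h : r.inEdge u = r.inEdge v) : u = v := by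
  by_cases hu : r.depth u = 0
  · rw [r.inEdge_of_depth_eq_zero hu] at h
    exact absurd ((r.depth_eq_zero v).2 (h ▸ r.mem_inEdge v)) hv
  · have h1 := (r.mem_inEdge_iff hv).1 (h ▸ r.mem_inEdge u)
    have h2 := (r.mem_inEdge_iff hu).1 (h ▸ r.mem_inEdge v)
    rcases h1 with h1 | h1
    · rcases h2 with h2 | h2
      · have h3 := r.depth_parent u hu
        have h4 := r.depth_parent v hv
        rw [← h2] at h3
        rw [← h1] at h4
        omega
      · exact h2.symm
    · exact h1

theorem depth_iterate_parent (j : ℕ) (w : V) (h : j ≤ r.depth w) :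
    r.depth (r.parent^[j] w) = r.depth w - j := by
  induction j with
  | zero => simp
  | succ j ih =>
    rw [Function.iterate_succ_apply']
    have h1 := ih (by omega)
    have := r.depth_parent (r.parent^[j] w) (by omega)
    omega

theorem depth_loc (t : ℕ) (w : V) : r.depth (r.loc t w) = min t (r.depth w) := by
  rw [loc, depth_iterate_parent _ _ _ (by omega)]
  omega

theorem loc_of_le {t : ℕ} {w : V} (h : r.depth w ≤ t) : r.loc t w = w := by
  simp [loc, Nat.sub_eq_zero_of_le h]

theorem loc_eq_parent {t : ℕ} {w : V} (h : t < r.depth w) :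
    r.loc t w = r.parent (r.loc (t + 1) w) := by
  rw [loc, loc, ← Function.iterate_succ_apply' r.parent]
  congr 1
  omega

theorem inEdge_loc_zero (w : V) : r.inEdge (r.loc 0 w) = r.root :=
  r.inEdge_of_depth_eq_zero (by simp [depth_loc])

theorem loc_succ_ne_loc {t : ℕ} {w : V} (h : t < r.depth w) {s : ℕ} (hs : s ≤ t) :
    r.loc s w ≠ r.loc (t + 1) w := by
  intro he
  have := congrArg r.depth he
  rw [depth_loc, depth_loc] at this
  omega

/-- The edge through which the system of `w` is sent in step `t + 1`. -/
def outEdge (t : ℕ) (w : V) : G.edgeSet := r.inEdge (r.loc (t + 1) w)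

theorem depth_loc_succ_ne_zero {t : ℕ} {w : V} (h : t < r.depth w) :
    r.depth (r.loc (t + 1) w) ≠ 0 := by
  rw [depth_loc]
  omega

theorem mem_outEdge_iff {t : ℕ} {v w : V} (h : t < r.depth w) :
    v ∈ (r.outEdge t w).1 ↔ v = r.loc t w ∨ v = r.loc (t + 1) w := by
  rw [outEdge, mem_inEdge_iff _ (r.depth_loc_succ_ne_zero h), loc_eq_parent _ h]

theorem inEdge_loc_ne_outEdge {t : ℕ} {w : V} (h : t < r.depth w) {s : ℕ} (hs : s ≤ t) :
    r.inEdge (r.loc s w) ≠ r.outEdge t w := fun he =>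
  r.loc_succ_ne_loc h hs (r.inEdge_inj (r.depth_loc_succ_ne_zero h) he)

/-- `Used t w e`: the source `e` is consumed in the transport of the system of `w`, or is the
original one, by the time `t`. -/
def Used (t : ℕ) (w : V) (e : G.edgeSet) : Prop := ∃ s ≤ t, e = r.inEdge (r.loc s w)

theorem used_root (t : ℕ) (w : V) : r.Used t w r.root :=
  ⟨0, Nat.zero_le t, (r.inEdge_loc_zero w).symm⟩

theorem used_zero_iff {w : V} {e : G.edgeSet} : r.Used 0 w e ↔ e = r.root := by
  simp [Used, inEdge_loc_zero]

theorem used_succ_iff {t : ℕ} {w : V} {e : G.edgeSet} :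
    r.Used (t + 1) w e ↔ r.Used t w e ∨ e = r.outEdge t w := by
  constructor
  · rintro ⟨s, hs, he⟩
    rcases Nat.lt_or_eq_of_le hs with hs | rfl
    · exact Or.inl ⟨s, by omega, he⟩
    · exact Or.inr he
  · rintro (⟨s, hs, he⟩ | he)
    · exact ⟨s, by omega, he⟩
    · exact ⟨t + 1, le_rfl, he⟩

theorem not_used_outEdge {t : ℕ} {w : V} (h : t < r.depth w) : ¬ r.Used t w (r.outEdge t w) := by
  rintro ⟨s, hs, he⟩
  exact r.inEdge_loc_ne_outEdge h hs he.symm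

theorem used_inEdge_loc (t : ℕ) (w : V) : r.Used t w (r.inEdge (r.loc t w)) := ⟨t, le_rfl, rfl⟩

theorem used_succ_iff_of_le {t : ℕ} {w : V} (h : r.depth w ≤ t) {e : G.edgeSet} :
    r.Used (t + 1) w e ↔ r.Used t w e := by
  rw [used_succ_iff, or_iff_left_iff_imp, outEdge, r.loc_of_le (h.trans t.le_succ)]
  rintro rfl
  have := r.used_inEdge_loc t w
  rwa [r.loc_of_le h] at this

end Routing

/-! ### The teleportation step -/

section Teleportation

open Classical in
/-- The part of `x` at the indices that satisfy `p`. -/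
noncomputable def mask {V : Type u} {D : V → Type u} [∀ v, AddCommGroup (D v)] (p : V → Prop)
    (x : ∀ v, D v) : ∀ v, D v := fun w => if p w then x w else 0

variable {V : Type u} [Fintype V] [DecidableEq V] {G : SimpleGraph V} [DecidableRel G.Adj]
  (D : V → Type u) [∀ v, Fintype (D v)] [∀ v, DecidableEq (D v)] [∀ v, AddCommGroup (D v)]
  (r : Routing G)

/-- Register of party `v`: a copy of the whole system for each incident edge. -/
abbrev Reg (G : SimpleGraph V) (v : V) : Type u := ∀ _ : {e : G.edgeSet // v ∈ e.1}, (∀ w, D w)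

/-- An assignment of classical labels to the sources. -/
abbrev Label (G : SimpleGraph V) : Type u := G.edgeSet → ∀ w, D w

variable {D}

namespace Routing

/-- The register of `v` at the edge towards the root. -/
def inReg {v : V} (i : Reg D G v) : ∀ w, D w := i ⟨r.inEdge v, r.mem_inEdge v⟩

open Classical in
/-- The basis state at time `t`, given the labels emitted by the sources. -/
noncomputable def config (t : ℕ) (y : Label D G) (v : V) : Reg D G v := fun e w =>
  -- The system of `w` sits at its current location, in the register towards the root. Elsewhere
  -- consumed registers are reset to 0, and both ends of a fresh source hold its label.
  if e.1 = r.inEdge v ∧ v = r.loc t w then y r.root w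
  else if r.Used t w e.1 then 0 else y e.1 w

/-- The labels of the consumed sources agree with those at the root. -/
def Consistent (t : ℕ) (y : Label D G) : Prop := ∀ w e, r.Used t w e → y e w = y r.root w

open Classical in
/-- The (unnormalised) state at time `t`. -/
noncomputable def stage (ψ : (∀ w, D w) → ℂ) (t : ℕ) : (∀ v, Reg D G v) → ℂ :=
  superposition (fun y : Label D G => if r.Consistent t y then ψ (y r.root) else 0) (r.config t)

/-- Party `v` sends the system of `w` in step `t + 1`. -/
def Out (t : ℕ) (v w : V) : Prop := t < r.depth w ∧ r.loc t w = v

/-- Party `v` receives the system of `w` in step `t + 1`. -/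
def In (t : ℕ) (v w : V) : Prop := t < r.depth w ∧ r.loc (t + 1) w = v

theorem Out.mem_outEdge {r : Routing G} {t : ℕ} {v w : V} (h : r.Out t v w) :
    v ∈ (r.outEdge t w).1 := (r.mem_outEdge_iff h.1).2 (Or.inl h.2.symm)

open Classical in
/-- The difference between the systems to be sent and the particles used for sending them. -/
noncomputable def syndrome (t : ℕ) (v : V) (i : Reg D G v) : ∀ w, D w := fun w =>
  if h : r.Out t v w then i ⟨r.outEdge t w, h.mem_outEdge⟩ w - r.inReg i w else 0

open Classical in
/-- Classical action of the measurement and the correction at `v`, given the received message. -/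
noncomputable def transport (t : ℕ) (v : V) (a : ∀ w, D w) (i : Reg D G v) : Reg D G v :=
  fun e w =>
    if r.Out t v w ∧ (e.1 = r.inEdge v ∨ e.1 = r.outEdge t w) then 0
    else if r.In t v w ∧ e.1 = r.inEdge v then i e w - a w else i e w

variable (D) in
/-- The outcome of a Bell measurement. -/
abbrev BellOutcome : Type u := (∀ w, D w) × AddChar (∀ w, D w) ℂ

/-- The amplitude of the outcome `o` at `v`, given the received message `o'`. -/
noncomputable def amplitude (t : ℕ) (v : V) (o o' : BellOutcome D) (i : Reg D G v) : ℂ :=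
  -- The first character value is the phase of the Bell measurement at `v`. The second is the
  -- correction: a receiver's particle is the sent value plus the measured difference `o'.1`, so the
  -- argument is minus the sent value. There are as many characters as labels, hence the square
  -- root.
  ((√(Fintype.card (∀ w, D w)))⁻¹ : ℝ) * (if o.1 = r.syndrome t v i then
    o.2 (mask (r.Out t v) (r.inReg i)) * o'.2 (mask (r.In t v) (o'.1 - r.inReg i)) else 0)

theorem eq_of_transport_eq {t : ℕ} {v : V} {a : ∀ w, D w} {i j : Reg D G v}
    (h : r.transport t v a i = r.transport t v a j) (hs : r.syndrome t v i = r.syndrome t v j)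
    (hm : mask (r.Out t v) (r.inReg i) = mask (r.Out t v) (r.inReg j)) : i = j := by
  funext e w
  have hw := congrFun (congrFun h e) w
  have hsw := congrFun hs w
  have hmw := congrFun hm w
  simp only [transport, syndrome, mask] at hw hsw hmw
  by_cases hout : r.Out t v w
  · simp only [hout, dif_pos, if_true, true_and] at hw hsw hmw
    rw [hmw, sub_left_inj] at hsw
    by_cases h1 : e.1 = r.inEdge v
    · obtain rfl : e = ⟨r.inEdge v, r.mem_inEdge v⟩ := Subtype.ext h1
      exact hmw
    · by_cases h2 : e.1 = r.outEdge t w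
      · obtain rfl : e = ⟨r.outEdge t w, hout.mem_outEdge⟩ := Subtype.ext h2
        exact hsw
      · simpa [h1, h2] using hw
  · simp only [hout, false_and, if_false] at hw
    by_cases hin : r.In t v w ∧ e.1 = r.inEdge v
    · simpa [hin] using hw
    · simpa [hin] using hw

/-- Completeness of the instrument: the outcome label forces equal syndromes, and orthogonality of
characters forces equal sent systems. With equal transports this gives `i = j`; the correction phase
then has modulus 1. -/
theorem sum_star_amplitude_mul (t : ℕ) (v : V) (o' : BellOutcome D) (i j : Reg D G v)
    (h : r.transport t v o'.1 i = r.transport t v o'.1 j) :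
    ∑ o, star (r.amplitude t v o o' i) * r.amplitude t v o o' j = if i = j then 1 else 0 := by
  have hc : (Fintype.card (∀ w, D w) : ℂ) ≠ 0 := by exact_mod_cast Fintype.card_ne_zero
  have hκ : ((((√(Fintype.card (∀ w, D w)))⁻¹ : ℝ)) : ℂ) * ((√(Fintype.card (∀ w, D w)))⁻¹ : ℝ) =
      (Fintype.card (∀ w, D w) : ℂ)⁻¹ := by
    rw [← Complex.ofReal_mul, ← mul_inv, Real.mul_self_sqrt (Nat.cast_nonneg _)]
    simp
  set x := mask (r.Out t v) (r.inReg i)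
  set x' := mask (r.Out t v) (r.inReg j)
  set p := star (o'.2 (mask (r.In t v) (o'.1 - r.inReg i))) *
    o'.2 (mask (r.In t v) (o'.1 - r.inReg j)) with hp
  have hterm : ∀ (a : ∀ w, D w) (χ : AddChar (∀ w, D w) ℂ),
      star (r.amplitude t v (a, χ) o' i) * r.amplitude t v (a, χ) o' j =
        (if a = r.syndrome t v i ∧ a = r.syndrome t v j then
          (Fintype.card (∀ w, D w) : ℂ)⁻¹ * p else 0) * χ (x' - x) := by
    intro a χ
    rw [amplitude, amplitude, star_mul', sub_eq_add_neg x' x, AddChar.map_add_eq_mul,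
      AddChar.map_neg_eq_conj, ← hκ]
    by_cases h1 : a = r.syndrome t v i
    · by_cases h2 : a = r.syndrome t v j
      · rw [if_pos h1, if_pos h2, if_pos ⟨h1, h2⟩, star_mul', hp]
        simp only [RCLike.star_def, Complex.conj_ofReal]
        ring
      · simp [h2]
    · simp [h1]
  rw [Fintype.sum_prod_type]
  simp only [hterm, ← Finset.mul_sum, AddChar.sum_apply_eq_ite, ← Finset.sum_mul]
  by_cases hx : x' - x = 0
  · rw [if_pos hx]
    by_cases hij : i = j
    · subst hij
      have hp1 : p = 1 := by
        rw [hp, RCLike.star_def, ← Complex.normSq_eq_conj_mul_self, Complex.normSq_eq_norm_sq]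
        simp
      simp only [hp1, and_self, if_true, Finset.sum_ite_eq', Finset.mem_univ, mul_one]
      exact inv_mul_cancel₀ hc
    · rw [if_neg hij, Finset.sum_eq_zero, zero_mul]
      intro a _
      refine if_neg fun ha => hij ?_
      exact r.eq_of_transport_eq h (ha.1.symm.trans ha.2) (sub_eq_zero.1 hx).symm
  · rw [if_neg hx, mul_zero, if_neg]
    rintro rfl
    exact hx (sub_self _)

/-- In step `t + 1`, the parties at depth `t` teleport the systems of their descendants to the
parties at depth `t + 1`. -/
noncomputable def teleport (t : ℕ) : Step G (Reg D G) (Reg D G) where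
  sends v w := v = r.parent w ∧ r.depth w = t + 1
  adj := by
    rintro v w ⟨rfl, h⟩
    exact r.adj w (by omega)
  not_both := by
    rintro v w x ⟨-, h⟩ ⟨rfl, h'⟩
    have := r.depth_parent x (by omega)
    omega
  out _ := BellOutcome D
  kraus v o m :=
    -- The default `(0, 1)` is harmless: away from depth `t + 1` nothing is received, so the message
    -- enters neither the transport nor the phase.
    let o' : BellOutcome D := if h : r.depth v = t + 1 then m (r.parent v) ⟨rfl, h⟩ else (0, 1)
    monomialMatrix (r.transport t v o'.1) (r.amplitude t v o o')
  complete v m := sum_conjTranspose_monomialMatrix_mul _ _ (r.sum_star_amplitude_mul t v _)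

end Routing

end Teleportation

theorem addChar_map_sum {ι A M : Type*} [AddCommMonoid A] [CommMonoid M] (χ : AddChar A M)
    (s : Finset ι) (f : ι → A) : χ (∑ i ∈ s, f i) = ∏ i ∈ s, χ (f i) :=
  map_prod χ.toMonoidHom (fun i => Multiplicative.ofAdd (f i)) s

/-! ### One teleportation step maps each stage to the next -/

section TeleportationStep

variable {V : Type u} [Fintype V] [DecidableEq V] {G : SimpleGraph V} [DecidableRel G.Adj]
  {D : V → Type u} [∀ v, Fintype (D v)] [∀ v, DecidableEq (D v)] [∀ v, AddCommGroup (D v)]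

namespace Routing

variable (r : Routing G)

theorem In.depth_eq {r : Routing G} {t : ℕ} {v w : V} (h : r.In t v w) : r.depth v = t + 1 := by
  rw [← h.2, depth_loc]
  exact min_eq_left h.1

theorem In.out_parent {r : Routing G} {t : ℕ} {v w : V} (h : r.In t v w) :
    r.Out t (r.parent v) w := ⟨h.1, by rw [r.loc_eq_parent h.1, h.2]⟩

theorem In.inEdge_eq {r : Routing G} {t : ℕ} {v w : V} (h : r.In t v w) :
    r.inEdge v = r.outEdge t w := by rw [outEdge, h.2]

theorem config_inReg_of_out {t : ℕ} {v w : V} (h : r.Out t v w) (y : Label D G) :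
    r.inReg (r.config t y v) w = y r.root w := by
  simp [inReg, config, h.2]

theorem config_outEdge_of_out {t : ℕ} {v w : V} (h : r.Out t v w) (y : Label D G) :
    r.config t y v ⟨r.outEdge t w, h.mem_outEdge⟩ w = y (r.outEdge t w) w := by
  have h1 : r.outEdge t w ≠ r.inEdge v := by
    rw [← h.2]
    exact (r.inEdge_loc_ne_outEdge h.1 le_rfl).symm
  simp [config, h1, r.not_used_outEdge h.1]

theorem config_inReg_of_in {t : ℕ} {v w : V} (h : r.In t v w) (y : Label D G) :
    r.inReg (r.config t y v) w = y (r.outEdge t w) w := by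
  have h1 : v ≠ r.loc t w := by
    rw [← h.2]
    exact (r.loc_succ_ne_loc h.1 le_rfl).symm
  simp [inReg, config, h1, h.inEdge_eq, r.not_used_outEdge h.1]

open Classical in
theorem config_of_not {t : ℕ} {y : Label D G} {v w : V} {e : {e : G.edgeSet // v ∈ e.1}}
    (h : ¬ (e.1 = r.inEdge v ∧ v = r.loc t w)) :
    r.config t y v e w = if r.Used t w e.1 then 0 else y e.1 w := by
  rw [config, if_neg h]

/-- The labels of the sources used in step `t + 1` differ by `α` from those at the root. -/
def Shifted (t : ℕ) (α : ∀ w, D w) (y : Label D G) : Prop :=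
  ∀ w, t < r.depth w → y (r.outEdge t w) w = y r.root w + α w

/-- The measured differences, by target. -/
def shift (t : ℕ) (m : V → BellOutcome D) : ∀ w, D w := fun w => (m (r.loc t w)).1 w

/-- Separates a condition on the outcomes alone, which decides whether the branch is zero, from a
constraint on the labels. -/
theorem eq_syndrome_iff (t : ℕ) (m : V → BellOutcome D) (y : Label D G) :
    (∀ v, (m v).1 = r.syndrome t v (r.config t y v)) ↔
      (∀ v w, ¬ r.Out t v w → (m v).1 w = 0) ∧ r.Shifted t (r.shift t m) y := by
  constructor
  · intro h
    refine ⟨fun v w hvw => by rw [h v]; simp [syndrome, hvw], fun w hw => ?_⟩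
    have hout : r.Out t (r.loc t w) w := ⟨hw, rfl⟩
    have := congrFun (h (r.loc t w)) w
    rw [syndrome, dif_pos hout, r.config_outEdge_of_out hout, r.config_inReg_of_out hout] at this
    rw [shift, this]
    abel
  · rintro ⟨h0, h⟩ v
    funext w
    by_cases hout : r.Out t v w
    · rw [syndrome, dif_pos hout, r.config_outEdge_of_out hout, r.config_inReg_of_out hout,
        h w hout.1, shift, hout.2]
      abel
    · rw [h0 v w hout, syndrome, dif_neg hout]

theorem transport_config {t : ℕ} {α : ∀ w, D w} {y : Label D G} (hy : r.Shifted t α y) (v : V)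
    {a : ∀ w, D w} (ha : ∀ w, r.In t v w → a w = α w) :
    r.transport t v a (r.config t y v) = r.config (t + 1) y v := by
  classical
  funext e w
  rw [transport]
  by_cases hw : t < r.depth w
  · by_cases hout : r.Out t v w
    · have h1 : v ≠ r.loc (t + 1) w := by
        rw [← hout.2]
        exact r.loc_succ_ne_loc hw le_rfl
      have hin : ¬ r.In t v w := fun h => h1 h.2.symm
      by_cases he : e.1 = r.inEdge v ∨ e.1 = r.outEdge t w
      · rw [if_pos ⟨hout, he⟩, config, if_neg fun h => h1 h.2, if_pos]
        rw [used_succ_iff]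
        refine he.imp_left fun he => ?_
        rw [he, ← hout.2]
        exact r.used_inEdge_loc t w
      · rw [not_or] at he
        rw [if_neg fun h => not_or.2 he h.2, if_neg fun h => hin h.1,
          r.config_of_not fun h => he.1 h.1, r.config_of_not fun h => he.1 h.1]
        simp only [used_succ_iff, he.2, or_false]
    · rw [if_neg fun h => hout h.1]
      have h0 : v ≠ r.loc t w := fun h => hout ⟨hw, h.symm⟩
      by_cases hin : r.In t v w
      · by_cases he : e.1 = r.inEdge v
        · obtain rfl : e = ⟨r.inEdge v, r.mem_inEdge v⟩ := Subtype.ext he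
          have h2 := r.config_inReg_of_in hin y
          rw [inReg] at h2
          rw [if_pos ⟨hin, rfl⟩, h2, hy w hw, ha w hin, add_sub_cancel_right, config,
            if_pos ⟨rfl, hin.2.symm⟩]
        · have he' : e.1 ≠ r.outEdge t w := hin.inEdge_eq ▸ he
          rw [if_neg fun h => he h.2, r.config_of_not fun h => he h.1,
            r.config_of_not fun h => he h.1]
          simp only [used_succ_iff, he', or_false]
      · have h1 : v ≠ r.loc (t + 1) w := fun h => hin ⟨hw, h.symm⟩
        have he' : e.1 ≠ r.outEdge t w := by
          intro he
          have := (r.mem_outEdge_iff hw).1 (he ▸ e.2)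
          exact this.elim h0 h1
        rw [if_neg fun h => hin h.1, r.config_of_not fun h => h0 h.2,
          r.config_of_not fun h => h1 h.2]
        simp only [used_succ_iff, he', or_false]
  · rw [if_neg fun h => hw h.1.1, if_neg fun h => hw h.1.1, config, config]
    rw [not_lt] at hw
    rw [r.loc_of_le hw, r.loc_of_le (hw.trans t.le_succ)]
    exact if_congr Iff.rfl rfl (if_congr (r.used_succ_iff_of_le hw).symm rfl rfl)

theorem sum_mask_in (t : ℕ) (u : V) (x : ∀ w, D w) :
    ∑ v ∈ Finset.univ.filter (fun v => r.parent v = u), mask (r.In t v) x = mask (r.Out t u) x := by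
  classical
  funext w
  rw [Finset.sum_apply, mask]
  by_cases hw : t < r.depth w
  · have h : ∀ v, mask (r.In t v) x w = if r.loc (t + 1) w = v then x w else 0 := fun v => by
      simp [mask, In, hw]
    simp only [h, Finset.sum_ite_eq, Finset.mem_filter_univ, Out, hw, true_and,
      r.loc_eq_parent hw]
  · rw [if_neg fun h => hw h.1]
    exact Finset.sum_eq_zero fun v _ => if_neg fun h => hw h.1

/-- Each system sent by `u` is received by exactly one child of `u`, so the corrections of the
children multiply to the inverse of the phase at `u`. -/
theorem prod_addChar_mask (t : ℕ) (χ : V → AddChar (∀ w, D w) ℂ) (x : ∀ w, D w) :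
    ∏ v, χ v (mask (r.Out t v) x) * χ (r.parent v) (-mask (r.In t v) x) = 1 := by
  have h : ∏ v, χ (r.parent v) (-mask (r.In t v) x) = ∏ v, χ v (-mask (r.Out t v) x) := by
    rw [← Finset.prod_fiberwise Finset.univ r.parent fun v => χ (r.parent v) (-mask (r.In t v) x)]
    refine Finset.prod_congr rfl fun u _ => ?_
    rw [← r.sum_mask_in, ← Finset.sum_neg_distrib, addChar_map_sum]
    exact Finset.prod_congr rfl fun v hv => by rw [(Finset.mem_filter_univ v).1 hv]
  rw [Finset.prod_mul_distrib, h, ← Finset.prod_mul_distrib]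
  refine Finset.prod_eq_one fun v _ => ?_
  rw [← AddChar.map_add_eq_mul, add_neg_cancel, AddChar.map_zero_eq_one]

theorem prod_amplitude_config {t : ℕ} {m m' : V → BellOutcome D}
    (hm : ∀ v, r.depth v = t + 1 → m' v = m (r.parent v)) (y : Label D G)
    (hy : ∀ v, (m v).1 = r.syndrome t v (r.config t y v)) :
    ∏ v, r.amplitude t v (m v) (m' v) (r.config t y v) =
      (((√(Fintype.card (∀ w, D w)))⁻¹ : ℝ) : ℂ) ^ Fintype.card V := by
  have hs := ((r.eq_syndrome_iff t m y).1 hy).2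
  have hout : ∀ v, mask (r.Out t v) (r.inReg (r.config t y v)) = mask (r.Out t v) (y r.root) := by
    intro v
    funext w
    by_cases h : r.Out t v w
    · simp [mask, h, r.config_inReg_of_out h]
    · simp [mask, h]
  have hin : ∀ v, (m' v).2 (mask (r.In t v) ((m' v).1 - r.inReg (r.config t y v))) =
      (m (r.parent v)).2 (-mask (r.In t v) (y r.root)) := by
    intro v
    by_cases hv : r.depth v = t + 1
    · rw [hm v hv]
      congr 1
      funext w
      by_cases h : r.In t v w
      · simp only [mask, h, if_true, Pi.neg_apply, Pi.sub_apply, r.config_inReg_of_in h,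
          hs w h.1, shift, h.out_parent.2]
        abel
      · simp [mask, h]
    · have h0 : ∀ x : ∀ w, D w, mask (r.In t v) x = 0 := fun x => by
        funext w
        exact if_neg fun h => hv h.depth_eq
      simp [h0]
  simp only [amplitude, if_pos (hy _), hout, hin]
  rw [Finset.prod_mul_distrib, r.prod_addChar_mask t fun v => (m v).2]
  simp

open Classical in
/-- Translation of the labels of the sources used in step `t + 1`. -/
noncomputable def shiftLabel (t : ℕ) (α : ∀ w, D w) : Label D G := fun e w =>
  if t < r.depth w ∧ e = r.outEdge t w then α w else 0

theorem shiftLabel_of_used {t : ℕ} {α : ∀ w, D w} {w : V} {e : G.edgeSet} (h : r.Used t w e) :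
    r.shiftLabel t α e w = 0 := by
  refine if_neg ?_
  rintro ⟨hw, rfl⟩
  exact r.not_used_outEdge hw h

theorem consistent_add_shiftLabel {t : ℕ} {α : ∀ w, D w} {y : Label D G} :
    r.Consistent t (y + r.shiftLabel t α) ↔ r.Consistent t y := by
  refine forall_congr' fun w => forall_congr' fun e => imp_congr_right fun he => ?_
  rw [Pi.add_apply, Pi.add_apply, Pi.add_apply, Pi.add_apply, r.shiftLabel_of_used he,
    r.shiftLabel_of_used (r.used_root t w), add_zero, add_zero]

theorem shifted_add_shiftLabel {t : ℕ} {α : ∀ w, D w} {y : Label D G} :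
    r.Shifted t α (y + r.shiftLabel t α) ↔ r.Shifted t 0 y := by
  refine forall_congr' fun w => imp_congr_right fun hw => ?_
  rw [Pi.add_apply, Pi.add_apply, Pi.add_apply, Pi.add_apply,
    r.shiftLabel_of_used (r.used_root t w), shiftLabel, if_pos ⟨hw, rfl⟩, add_zero, add_left_inj,
    Pi.zero_apply, add_zero]

theorem consistent_succ_iff {t : ℕ} {y : Label D G} :
    r.Consistent (t + 1) y ↔ r.Consistent t y ∧ r.Shifted t 0 y := by
  constructor
  · intro h
    refine ⟨fun w e he => h w e (r.used_succ_iff.2 (Or.inl he)), fun w _ => ?_⟩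
    rw [h w _ (r.used_succ_iff.2 (Or.inr rfl)), Pi.zero_apply, add_zero]
  · rintro ⟨h, h'⟩ w e he
    by_cases hw : t < r.depth w
    · rcases r.used_succ_iff.1 he with he | rfl
      · exact h w e he
      · rw [h' w hw, Pi.zero_apply, add_zero]
    · exact h w e ((r.used_succ_iff_of_le (not_lt.1 hw)).1 he)

theorem config_succ_add_shiftLabel (t : ℕ) (α : ∀ w, D w) (y : Label D G) :
    r.config (t + 1) (y + r.shiftLabel t α) = r.config (t + 1) y := by
  funext v e w
  rw [config, config, Pi.add_apply, Pi.add_apply, Pi.add_apply, Pi.add_apply,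
    r.shiftLabel_of_used (r.used_root t w), add_zero]
  refine if_congr Iff.rfl rfl ?_
  split_ifs with h
  · rfl
  · rw [shiftLabel, if_neg, add_zero]
    rintro ⟨-, he⟩
    exact h (r.used_succ_iff.2 (Or.inr he))

/-- Within a branch all phases cancel, so the amplitude changes by a constant and the labels are
confined to those with the measured shift. Translating the labels of the sources just consumed makes
the shift zero, which is consistency at time `t + 1`; the new configuration does not see those
labels. -/
theorem teleport_mulVec_stage (ψ : (∀ w, D w) → ℂ) (t : ℕ) (m : V → BellOutcome D) :
    ∃ c : ℂ, (tensorOp fun v => (r.teleport (D := D) t).kraus v (m v) fun w _ => m w).mulVec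
      (r.stage ψ t) = c • r.stage ψ (t + 1) := by
  classical
  set m' : V → BellOutcome D := fun v => if r.depth v = t + 1 then m (r.parent v) else (0, 1)
    with hm'
  set κ : ℂ := (((√(Fintype.card (∀ w, D w)))⁻¹ : ℝ) : ℂ) ^ Fintype.card V with hκ
  have hK : (tensorOp fun v => (r.teleport (D := D) t).kraus v (m v) fun w _ => m w) =
      monomialMatrix (fun i v => r.transport t v (m' v).1 (i v))
        (fun i => ∏ v, r.amplitude t v (m v) (m' v) (i v)) := by
    rw [← tensorOp_monomialMatrix]
    rfl
  have hM : ∀ v w, r.In t v w → (m' v).1 w = r.shift t m w := by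
    intro v w h
    simp only [hm', h.depth_eq, if_true, shift, h.out_parent.2]
  rw [hK, stage, monomialMatrix_mulVec_superposition]
  have hamp : ∀ y, (if r.Consistent t y then ψ (y r.root) else 0) *
      ∏ v, r.amplitude t v (m v) (m' v) (r.config t y v) =
      if (∀ v w, ¬ r.Out t v w → (m v).1 w = 0) then
        κ * (if r.Consistent t y ∧ r.Shifted t (r.shift t m) y then ψ (y r.root) else 0) else 0 := by
    intro y
    by_cases hy : ∀ v, (m v).1 = r.syndrome t v (r.config t y v)
    · rw [r.prod_amplitude_config (fun v hv => by simp [hm', hv]) y hy]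
      have := (r.eq_syndrome_iff t m y).1 hy
      rw [if_pos this.1]
      simp only [this.2, and_true]
      ring
    · have h0 : ∏ v, r.amplitude t v (m v) (m' v) (r.config t y v) = 0 := by
        push Not at hy
        obtain ⟨v, hv⟩ := hy
        exact Finset.prod_eq_zero (Finset.mem_univ v) (by rw [amplitude, if_neg hv, mul_zero])
      rw [h0, mul_zero]
      rw [eq_syndrome_iff, not_and] at hy
      split_ifs with h1 h2
      · exact absurd h2.2 (hy h1)
      · simp
      · rfl
  by_cases hsupp : ∀ v w, ¬ r.Out t v w → (m v).1 w = 0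
  · refine ⟨κ, ?_⟩
    rw [superposition_congr (c' := fun y => κ * if r.Consistent t y ∧ r.Shifted t (r.shift t m) y
      then ψ (y r.root) else 0) (g' := r.config (t + 1)),
      superposition_const_mul]
    · congr 1
      rw [← superposition_comp_equiv _ _ (Equiv.addRight (r.shiftLabel t (r.shift t m)))]
      refine superposition_congr (fun y => ?_) fun y _ => ?_
      · simp only [Function.comp_apply, Equiv.coe_addRight, consistent_add_shiftLabel,
          shifted_add_shiftLabel, consistent_succ_iff]
        congr 2
        funext w
        rw [Pi.add_apply, Pi.add_apply, r.shiftLabel_of_used (r.used_root t w), add_zero]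
      · exact r.config_succ_add_shiftLabel t _ y
    · intro y
      rw [hamp, if_pos hsupp]
    · intro y hy
      rw [hamp, if_pos hsupp] at hy
      have hsh : r.Shifted t (r.shift t m) y := by
        by_contra h
        exact hy (by simp [h])
      funext v
      exact r.transport_config hsh v (hM v)
  -- A nonzero difference reported where nothing is sent has probability zero.
  · refine ⟨0, ?_⟩
    rw [superposition_congr (c' := fun y => 0 * 0) (g' := r.config (t + 1)),
      superposition_const_mul, zero_smul, zero_smul]
    · intro y
      rw [hamp, if_neg hsupp, mul_zero]
    · intro y hy
      rw [hamp, if_neg hsupp] at hy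
      exact absurd rfl hy

end Routing

end TeleportationStep

/-! ### Preparing a pure state along a routing -/

section UpperBound

variable {V : Type u} [Fintype V] [DecidableEq V] {G : SimpleGraph V} [DecidableRel G.Adj]
  {D : V → Type u} [∀ v, Fintype (D v)] [∀ v, DecidableEq (D v)] [∀ v, AddCommGroup (D v)]

namespace Routing

variable (r : Routing G)

/-- The particles emitted by the source `e` with label `z`. -/
noncomputable def emit (e : G.edgeSet) (z : ∀ w, D w) : {v // v ∈ e.1} → ∀ w, D w := fun v =>
  if e = r.root then mask (fun w => r.loc 0 w = v) z else z

theorem emit_injective (e : G.edgeSet) : Function.Injective (r.emit (D := D) e) := by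
  intro z z' h
  by_cases he : e = r.root
  · funext w
    have hw : r.loc 0 w ∈ e.1 := by
      rw [he, ← r.inEdge_loc_zero w]
      exact r.mem_inEdge _
    simpa [emit, he, mask] using congrFun (congrFun h ⟨_, hw⟩) w
  · obtain ⟨v, hv⟩ : ∃ v, v ∈ e.1 := ⟨_, Sym2.out_fst_mem e.1⟩
    simpa [emit, he] using congrFun h ⟨v, hv⟩

/-- The amplitude of the label `z` at the source `e`. -/
noncomputable def sourceAmplitude (ψ : (∀ w, D w) → ℂ) (e : G.edgeSet) (z : ∀ w, D w) : ℂ :=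
  if e = r.root then ψ z else ((√(Fintype.card (∀ w, D w)))⁻¹ : ℝ)

theorem sum_norm_sq_sourceAmplitude {ψ : (∀ w, D w) → ℂ} (hψ : ∑ i, ‖ψ i‖ ^ 2 = 1)
    (e : G.edgeSet) : ∑ z, ‖r.sourceAmplitude ψ e z‖ ^ 2 = 1 := by
  by_cases he : e = r.root
  · simpa [sourceAmplitude, he] using hψ
  · have hc : (Fintype.card (∀ w, D w) : ℝ) ≠ 0 := by exact_mod_cast Fintype.card_ne_zero
    simp only [sourceAmplitude, he, if_false, Complex.norm_real, Real.norm_eq_abs, sq_abs,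
      inv_pow, Finset.sum_const, Finset.card_univ, nsmul_eq_mul,
      Real.sq_sqrt (Nat.cast_nonneg (Fintype.card (∀ w, D w)))]
    exact mul_inv_cancel₀ hc

/-- The root source emits the target state, split between its two ends; all other sources emit
maximally entangled states. -/
noncomputable def sources {ψ : (∀ w, D w) → ℂ} (hψ : ∑ i, ‖ψ i‖ ^ 2 = 1) : GState G where
  S _ _ := ∀ w, D w
  γ e := Matrix.vecMulVec (superposition (r.sourceAmplitude ψ e) (r.emit e))
    (star (superposition (r.sourceAmplitude ψ e) (r.emit e)))
  density e := isDensity_vecMulVec (by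
    rw [sum_norm_sq_superposition _ (r.emit_injective e), r.sum_norm_sq_sourceAmplitude hψ])

theorem eq_config_zero_iff (i : ∀ v, Reg D G v) (y : Label D G) :
    i = r.config 0 y ↔ ∀ e : G.edgeSet, (fun v : {v // v ∈ e.1} => i v.1 ⟨e, v.2⟩) =
      r.emit e (y e) := by
  classical
  have h : ∀ (e : G.edgeSet) (v : {v // v ∈ e.1}), r.config 0 y v.1 ⟨e, v.2⟩ = r.emit e (y e) v := by
    intro e v
    funext w
    by_cases he : e = r.root
    · subst he
      have hv : r.inEdge v.1 = r.root := r.inEdge_of_depth_eq_zero ((r.depth_eq_zero _).2 v.2)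
      simp [config, emit, mask, hv, used_zero_iff, eq_comm]
    · rw [r.config_of_not, if_neg, emit, if_neg he]
      · rwa [used_zero_iff]
      · rintro ⟨h1, h2⟩
        exact he (h1.trans ((congrArg r.inEdge h2).trans (r.inEdge_loc_zero w)))
  constructor
  · rintro rfl e
    exact funext fun v => h e v
  · intro hi
    funext v e
    exact (congrFun (hi e.1) ⟨v, e.2⟩).trans (h e.1 ⟨v, e.2⟩).symm

/-- Expanding the product of sums chooses one label per source, that is, a `Label`. Consistency at
time 0 is automatic, as only the root source counts as used. -/
theorem prod_superposition_emit (ψ : (∀ w, D w) → ℂ) : ∃ c : ℂ, ∀ i : ∀ v, Reg D G v,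
    ∏ e : G.edgeSet, superposition (r.sourceAmplitude ψ e) (r.emit e)
      (fun v : {v // v ∈ e.1} => i v.1 ⟨e, v.2⟩) = c * r.stage ψ 0 i := by
  classical
  refine ⟨∏ e ∈ Finset.univ.erase r.root, (((√(Fintype.card (∀ w, D w)))⁻¹ : ℝ) : ℂ), fun i => ?_⟩
  simp only [superposition, stage]
  rw [Finset.prod_univ_sum, Fintype.piFinset_univ, Finset.mul_sum]
  refine Finset.sum_congr rfl fun y _ => ?_
  have hcons : r.Consistent 0 y := fun w e he => by rw [r.used_zero_iff.1 he]
  rw [Fintype.prod_ite_zero, if_pos hcons]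
  have hamp : ∏ e, r.sourceAmplitude ψ e (y e) = (∏ e ∈ Finset.univ.erase r.root,
      (((√(Fintype.card (∀ w, D w)))⁻¹ : ℝ) : ℂ)) * ψ (y r.root) := by
    rw [← Finset.mul_prod_erase _ _ (Finset.mem_univ r.root), mul_comm]
    congr 1
    · exact Finset.prod_congr rfl fun e he => if_neg (Finset.ne_of_mem_erase he)
    · exact if_pos rfl
  rw [hamp, mul_ite, mul_zero]
  exact if_congr (r.eq_config_zero_iff i y).symm rfl rfl

theorem exists_sources_state_eq {ψ : (∀ w, D w) → ℂ} (hψ : ∑ i, ‖ψ i‖ ^ 2 = 1) :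
    ∃ c : ℂ, (r.sources hψ).state = c • Matrix.vecMulVec (r.stage ψ 0) (star (r.stage ψ 0)) := by
  obtain ⟨c, hc⟩ := r.prod_superposition_emit ψ
  refine ⟨c * star c, ?_⟩
  refine Matrix.ext fun (i j : ∀ v, Reg D G v) => ?_
  have h : (r.sources hψ).state i j = (c * r.stage ψ 0 i) * star (c * r.stage ψ 0 j) := by
    rw [← hc i, ← hc j]
    simp only [GState.state, sources, Matrix.vecMulVec_apply, Pi.star_apply,
      RCLike.star_def, map_prod]
    exact Finset.prod_mul_distrib
  refine h.trans ?_
  change _ = c * star c * (r.stage ψ 0 i * star (r.stage ψ 0 j))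
  rw [star_mul']
  ring

open Classical in
/-- The register of `v` without the system of `v`. -/
noncomputable def rest (v : V) (i : Reg D G v) : Reg D G v := fun e w =>
  if e.1 = r.inEdge v ∧ w = v then 0 else i e w

theorem eq_of_rest_eq {v : V} {i j : Reg D G v} (h : r.rest v i = r.rest v j)
    (hv : r.inReg i v = r.inReg j v) : i = j := by
  funext e w
  by_cases he : e.1 = r.inEdge v ∧ w = v
  · obtain ⟨he, rfl⟩ := he
    obtain rfl : e = ⟨r.inEdge w, r.mem_inEdge w⟩ := Subtype.ext he
    exact hv
  · simpa [rest, he] using congrFun (congrFun h e) w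

/-- Every party keeps its system and measures the rest of its register. -/
noncomputable def readout : Step G (Reg D G) D where
  sends _ _ := False
  adj _ _ h := h.elim
  not_both _ _ _ h := h.elim
  out v := Reg D G v
  kraus v k _ := monomialMatrix (fun i => r.inReg i v) (fun i => if k = r.rest v i then 1 else 0)
  complete v m := by
    refine sum_conjTranspose_monomialMatrix_mul _ _ fun i j h => ?_
    by_cases hij : i = j
    · subst hij
      simp
    · rw [if_neg hij]
      refine Finset.sum_eq_zero fun k _ => ?_
      by_cases hi : k = r.rest v i
      · have hj : k ≠ r.rest v j := fun hj => hij (r.eq_of_rest_eq (hi.symm.trans hj) h)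
        simp [hj]
      · simp [hi]

open Classical in
/-- Translation of the labels of the consumed sources. -/
noncomputable def usedLabel (t : ℕ) (z : ∀ w, D w) : Label D G := fun e w =>
  if r.Used t w e then z w else 0

theorem consistent_add_usedLabel {t : ℕ} {z : ∀ w, D w} {y : Label D G} :
    r.Consistent t (y + r.usedLabel t z) ↔ r.Consistent t y := by
  refine forall_congr' fun w => forall_congr' fun e => imp_congr_right fun he => ?_
  simp [usedLabel, he, r.used_root t w]

/-- The registers to be measured carry no trace of the target's label, so measuring them does not
disturb the target state. -/
theorem rest_config_add_usedLabel {t : ℕ} (ht : ∀ v, r.depth v ≤ t) (y : Label D G)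
    (z : ∀ w, D w) (v : V) :
    r.rest v (r.config t (y + r.usedLabel t z) v) = r.rest v (r.config t y v) := by
  funext e w
  rw [rest, rest]
  by_cases he : e.1 = r.inEdge v ∧ w = v
  · rw [if_pos he, if_pos he]
  · have he' : ¬ (e.1 = r.inEdge v ∧ v = r.loc t w) := by
      rw [r.loc_of_le (ht w)]
      exact fun h => he ⟨h.1, h.2.symm⟩
    rw [if_neg he, if_neg he, r.config_of_not he', r.config_of_not he']
    split_ifs with hu
    · rfl
    · simp [usedLabel, hu]

theorem readout_mulVec_stage (ψ : (∀ w, D w) → ℂ) {t : ℕ} (ht : ∀ v, r.depth v ≤ t)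
    (k : ∀ v, Reg D G v) :
    ∃ c : ℂ, (tensorOp fun v => (r.readout (D := D)).kraus v (k v) fun w _ => k w).mulVec
      (r.stage ψ t) = c • ψ := by
  classical
  have hK : (tensorOp fun v => (r.readout (D := D)).kraus v (k v) fun w _ => k w) =
      monomialMatrix (fun i v => r.inReg (i v) v)
        (fun i => ∏ v, if k v = r.rest v (i v) then 1 else 0) :=
    tensorOp_monomialMatrix (fun v (i : Reg D G v) => r.inReg i v)
      fun v i => if k v = r.rest v i then 1 else 0
  let good : Label D G → Prop := fun y =>
    r.Consistent t y ∧ ∀ v, k v = r.rest v (r.config t y v)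
  rw [hK, stage, monomialMatrix_mulVec_superposition,
    superposition_congr (c' := fun y => if good y then ψ (y r.root) else 0)
      (g' := fun y => y r.root)]
  -- Translation by `z` matches the good labels with value `z` at the root with those of value 0, so
  -- every `z` has the same multiplicity: this scalar.
  · refine ⟨∑ y : Label D G, if y r.root = 0 ∧ good y then 1 else 0, ?_⟩
    funext z
    rw [superposition, Pi.smul_apply, smul_eq_mul, Finset.sum_mul,
      ← Equiv.sum_comp (Equiv.addRight (r.usedLabel t z))]
    refine Finset.sum_congr rfl fun y _ => ?_
    have hz : (y + r.usedLabel t z) r.root = y r.root + z := by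
      funext w
      simp [usedLabel, r.used_root t w]
    have hg : good (y + r.usedLabel t z) ↔ good y := by
      simp only [good, consistent_add_usedLabel, r.rest_config_add_usedLabel ht]
    simp only [Equiv.coe_addRight, hz, hg, right_eq_add]
    by_cases h0 : y r.root = 0 <;> simp [h0]
  · intro y
    rw [Fintype.prod_ite_zero, Finset.prod_const_one]
    by_cases h1 : r.Consistent t y <;> by_cases h2 : ∀ v, k v = r.rest v (r.config t y v) <;>
      simp [good, h1, h2]
  · intro y _
    funext v
    simp [inReg, config, r.loc_of_le (ht v)]

theorem exists_isLOCC_stage {ψ : (∀ w, D w) → ℂ} (hψ : ∑ i, ‖ψ i‖ ^ 2 = 1) (t : ℕ) :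
    ∃ Λ : Op (r.sources hψ).Local → Op (Reg D G),
      IsLOCC G (r.sources hψ).Local t (Reg D G) Λ ∧
        ∃ c : ℂ, Λ (r.sources hψ).state = c • Matrix.vecMulVec (r.stage ψ t) (star (r.stage ψ t)) := by
  induction t with
  | zero => exact ⟨id, IsLOCC.refl, r.exists_sources_state_eq hψ⟩
  | succ t ih =>
    obtain ⟨Λ, hΛ, c, hc⟩ := ih
    exact ⟨_, hΛ.step (r.teleport t),
      (r.teleport t).exists_map_eq_smul_vecMulVec (r.teleport_mulVec_stage ψ t) hc⟩

theorem mem_preparable {ρ : Op D} (hρ : IsPure ρ) {t : ℕ} (ht : ∀ v, r.depth v ≤ t) :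
    ρ ∈ preparable G t := by
  obtain ⟨ψ, hψ, rfl⟩ := hρ
  obtain ⟨Λ, hΛ, c, hc⟩ := r.exists_isLOCC_stage hψ t
  have hΛ' := hΛ.localOp r.readout fun _ _ h => h
  obtain ⟨c', hc'⟩ := r.readout.exists_map_eq_smul_vecMulVec (r.readout_mulVec_stage ψ ht) hc
  refine ⟨r.sources hψ, 1, fun _ => 1, fun _ => _, by simp, fun _ => hΛ', ?_⟩
  have htr := (hΛ'.isDensity (r.sources hψ).isDensity_state).2
  rw [Function.comp_apply, hc', Matrix.trace_smul, (isDensity_vecMulVec hψ).2, smul_eq_mul,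
    mul_one] at htr
  simp [hc', htr]

end Routing

theorem mem_preparable_of_routing {V : Type u} [Fintype V] [DecidableEq V] {G : SimpleGraph V}
    [DecidableRel G.Adj] {D : V → Type u} [∀ v, Fintype (D v)] [∀ v, DecidableEq (D v)]
    (r : Routing G) {ρ : Op D} (hρ : IsPure ρ) {t : ℕ} (ht : ∀ v, r.depth v ≤ t) :
    ρ ∈ preparable G t := by
  have hne : Nonempty (∀ v, D v) := by
    by_contra h
    rw [not_nonempty_iff] at h
    obtain ⟨ψ, hψ, -⟩ := hρ
    simp at hψ
  have hcard : ∀ v, NeZero (Fintype.card (D v)) := fun v =>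
    ⟨(Fintype.card_pos_iff.2 ⟨hne.some v⟩).ne'⟩
  -- Bell measurements need some abelian group structure on the basis labels; a cyclic group will
  -- do. The sets are nonempty because `ψ` is a unit vector.
  let _ : ∀ v, AddCommGroup (D v) := fun v => (Fintype.equivFin (D v)).addCommGroup
  exact r.mem_preparable hρ ht

end UpperBound

/-! ### Edge radius and longest paths of a tree -/

section EdgeRadius

variable {V : Type u} {G : SimpleGraph V}

theorem iInf_mem_sym2 {α : Type*} [CompleteLattice α] (f : V → α) (x y : V) :
    ⨅ v ∈ s(x, y), f v = f x ⊓ f y := by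
  simp only [Sym2.mem_iff, iInf_or, iInf_inf_eq, iInf_iInf_eq_left]

theorem iSup_iInf_edist_le_iff (hG : G.Connected) {x y : V} {n : ℕ} :
    ⨆ u : V, ⨅ v ∈ s(x, y), G.edist u v ≤ n ↔ ∀ u, G.dist u x ≤ n ∨ G.dist u y ≤ n := by
  simp only [iSup_le_iff, iInf_mem_sym2, inf_le_iff, ← (hG _ _).coe_dist_eq_edist, Nat.cast_le]

/-- The spanning forest of the shortest paths to the edge `s(x, y)`. -/
theorem exists_routing (hG : G.Connected) {x y : V} (hxy : G.Adj x y) {n : ℕ}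
    (h : ∀ u, G.dist u x ≤ n ∨ G.dist u y ≤ n) : ∃ r : Routing G, ∀ v, r.depth v ≤ n := by
  let d : V → ℕ := fun v => min (G.dist v x) (G.dist v y)
  have hnear : ∀ v z, G.dist v z ≠ 0 → ∃ u, G.Adj u v ∧ G.dist u z + 1 ≤ G.dist v z := by
    intro v z hv
    obtain ⟨p, hp⟩ := (hG v z).exists_walk_length_eq_dist
    cases p with
    | nil => simp at hv
    | @cons _ u _ hvu q =>
      refine ⟨u, hvu.symm, ?_⟩
      rw [← hp, SimpleGraph.Walk.length_cons]
      exact Nat.succ_le_succ (SimpleGraph.dist_le q)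
  have hlip : ∀ u v z, G.Adj u v → G.dist v z ≤ G.dist u z + 1 := by
    intro u v z huv
    have := hG.dist_triangle (u := v) (v := u) (w := z)
    rw [SimpleGraph.dist_eq_one_iff_adj.2 huv.symm] at this
    omega
  -- The parent is the next vertex on a shortest path to the nearer end; as distances change by at
  -- most 1 along an edge, the depth drops by exactly 1.
  have hpar : ∀ v, ∃ u, d v ≠ 0 → G.Adj u v ∧ d u + 1 = d v := by
    intro v
    by_cases hv : d v = 0
    · exact ⟨v, fun h => absurd hv h⟩
    · have hx : G.dist v x ≠ 0 := by simp only [d] at hv; omega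
      have hy : G.dist v y ≠ 0 := by simp only [d] at hv; omega
      rcases le_total (G.dist v x) (G.dist v y) with hle | hle
      · obtain ⟨u, hu, hd⟩ := hnear v x hx
        have h1 := hlip u v x hu
        have h2 := hlip u v y hu
        exact ⟨u, fun _ => ⟨hu, by simp only [d]; omega⟩⟩
      · obtain ⟨u, hu, hd⟩ := hnear v y hy
        have h1 := hlip u v x hu
        have h2 := hlip u v y hu
        exact ⟨u, fun _ => ⟨hu, by simp only [d]; omega⟩⟩
  choose par hpar using hpar
  refine ⟨⟨⟨s(x, y), hxy⟩, d, par, fun v => ?_, fun v hv => (hpar v hv).1,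
    fun v hv => (hpar v hv).2⟩, fun v => ?_⟩
  · have hx := (hG v x).dist_eq_zero_iff
    have hy := (hG v y).dist_eq_zero_iff
    rw [Sym2.mem_iff, ← hx, ← hy]
    simp only [d]
    omega
  · have := h v
    simp only [d]
    omega

theorem dist_eq_length_of_isPath (hG : G.IsTree) {a b : V} {P : G.Walk a b} (hP : P.IsPath) :
    G.dist a b = P.length := by
  obtain ⟨Q, hQ, hQl⟩ := (hG.connected a b).exists_path_of_dist
  rw [← hQl, (hG.existsUnique_path a b).unique hQ hP]

/-- In a tree, every vertex has at most one neighbour which is closer to `u`. -/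
theorem closer_neighbor_unique (hG : G.IsTree) {u y x₁ x₂ : V} (h₁ : G.Adj x₁ y) (h₂ : G.Adj x₂ y)
    (hd₁ : G.dist u y = G.dist u x₁ + 1) (hd₂ : G.dist u y = G.dist u x₂ + 1) : x₁ = x₂ := by
  obtain ⟨p₁, hp₁⟩ := (hG.connected u x₁).exists_walk_length_eq_dist
  obtain ⟨p₂, hp₂⟩ := (hG.connected u x₂).exists_walk_length_eq_dist
  have hq₁ : (p₁.concat h₁).IsPath :=
    SimpleGraph.Walk.isPath_of_length_eq_dist _ (by simp [hp₁, hd₁])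
  have hq₂ : (p₂.concat h₂).IsPath :=
    SimpleGraph.Walk.isPath_of_length_eq_dist _ (by simp [hp₂, hd₂])
  have := congrArg SimpleGraph.Walk.penultimate ((hG.existsUnique_path u y).unique hq₁ hq₂)
  simpa using this

/-- In a tree, the distance to `u` keeps growing along a path once it starts to grow. -/
theorem dist_getVert_add (hG : G.IsTree) {a b : V} {P : G.Walk a b} (hP : P.IsPath) (u : V)
    {i : ℕ} (hi : G.dist u (P.getVert (i + 1)) = G.dist u (P.getVert i) + 1) (k : ℕ)
    (hk : i + (k + 1) ≤ P.length) :
    G.dist u (P.getVert (i + (k + 1))) = G.dist u (P.getVert (i + k)) + 1 ∧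
      G.dist u (P.getVert (i + (k + 1))) = G.dist u (P.getVert i) + (k + 1) := by
  induction k with
  | zero => exact ⟨hi, hi⟩
  | succ k ih =>
    obtain ⟨h1, h2⟩ := ih (by omega)
    have hadj : G.Adj (P.getVert (i + (k + 1))) (P.getVert (i + (k + 1) + 1)) :=
      P.adj_getVert_succ (by omega)
    have hadj' : G.Adj (P.getVert (i + k)) (P.getVert (i + k + 1)) :=
      P.adj_getVert_succ (by omega)
    rcases hG.dist_eq_dist_add_one_of_adj u hadj with h | h
    -- Were the distance to fall here, both path neighbours of this vertex would be closer to `u`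
    -- and hence equal.
    · have := closer_neighbor_unique hG hadj.symm hadj' h h1
      have := hP.getVert_injOn (by simp only [Set.mem_ofPred_eq]; omega)
        (by simp only [Set.mem_ofPred_eq]; omega) this
      omega
    · refine ⟨h, ?_⟩
      exact h.trans (by rw [h2, add_assoc])

/-- The middle edge has an end nearer to `u`. From there across the edge to the far end of `P` the
distance to `u` keeps growing, yet it never exceeds `P.length`; this bounds the distance at the
start. -/
theorem dist_getVert_le_or (hG : G.IsTree) {a b : V} {P : G.Walk a b} (hP : P.IsPath) (hab : a ≠ b)
    (hlongest : ∀ (x y : V) (Q : G.Walk x y), Q.IsPath → Q.length ≤ P.length) (u : V) :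
    G.dist u (P.getVert (P.length / 2)) ≤ P.length / 2 ∨
      G.dist u (P.getVert (P.length / 2 + 1)) ≤ P.length / 2 := by
  have hpos : P.length ≠ 0 := fun h => hab (SimpleGraph.Walk.eq_of_length_eq_zero h)
  have hdist : ∀ x, G.dist u x ≤ P.length := by
    intro x
    obtain ⟨Q, hQ, hQl⟩ := (hG.connected u x).exists_path_of_dist
    exact hQl ▸ hlongest u x Q hQ
  set n := P.length / 2 with hn
  have hadj : G.Adj (P.getVert n) (P.getVert (n + 1)) := P.adj_getVert_succ (by omega)
  rcases hG.dist_eq_dist_add_one_of_adj u hadj with h | h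
  · right
    have e1 : P.reverse.getVert (P.length - (n + 1)) = P.getVert (n + 1) := by
      rw [SimpleGraph.Walk.getVert_reverse]
      congr 1
      omega
    have e2 : P.reverse.getVert (P.length - (n + 1) + 1) = P.getVert n := by
      rw [SimpleGraph.Walk.getVert_reverse]
      congr 1
      omega
    have := (dist_getVert_add hG hP.reverse u (i := P.length - (n + 1)) (by rw [e1, e2, h]) n
      (by rw [SimpleGraph.Walk.length_reverse]; omega)).2
    have h1 := hdist (P.reverse.getVert (P.length - (n + 1) + (n + 1)))
    rw [this, e1] at h1
    omega
  · left
    obtain ⟨k, hk⟩ : ∃ k, P.length = n + (k + 1) := ⟨P.length - n - 1, by omega⟩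
    have := (dist_getVert_add hG hP u h k hk.ge).2
    have h1 := hdist (P.getVert (n + (k + 1)))
    rw [this] at h1
    omega

/-- The edge radius of a tree is half of its diameter, rounded down. -/
theorem edgeRadius_eq (hG : G.IsTree) {a b : V} {P : G.Walk a b} (hP : P.IsPath) (hab : a ≠ b)
    (hlongest : ∀ (x y : V) (Q : G.Walk x y), Q.IsPath → Q.length ≤ P.length) :
    edgeRadius G = ((P.length / 2 : ℕ) : ℕ∞) := by
  have hpos : P.length ≠ 0 := fun h => hab (SimpleGraph.Walk.eq_of_length_eq_zero h)
  refine le_antisymm ?_ (le_iInf₂ fun e he => ?_)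
  · have hadj : G.Adj (P.getVert (P.length / 2)) (P.getVert (P.length / 2 + 1)) :=
      P.adj_getVert_succ (by omega)
    exact (iInf₂_le s(_, _) hadj).trans ((iSup_iInf_edist_le_iff hG.connected).2
      (dist_getVert_le_or hG hP hab hlongest))
  · induction e using Sym2.ind with
    | _ x y =>
      -- If `a` and `b` were both within `n < P.length / 2` of the edge, their distance would be at
      -- most `2 * n + 1 < P.length`.
      by_contra! hlt
      obtain ⟨n, hn⟩ := ENat.ne_top_iff_exists.1 (hlt.trans (ENat.natCast_lt_top _)).ne
      rw [← hn, Nat.cast_lt] at hlt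
      have h := (iSup_iInf_edist_le_iff hG.connected).1 hn.ge
      have hxy : G.dist x y = 1 := SimpleGraph.dist_eq_one_iff_adj.2 he
      have hyx : G.dist y x = 1 := SimpleGraph.dist_eq_one_iff_adj.2 he.symm
      have hd := dist_eq_length_of_isPath hG hP
      have htri : ∀ z w, G.dist a b ≤ G.dist a z + G.dist z w + G.dist b w := by
        intro z w
        have h1 := hG.connected.dist_triangle (u := a) (v := z) (w := b)
        have h2 := hG.connected.dist_triangle (u := z) (v := w) (w := b)
        rw [G.dist_comm (u := w)] at h2
        omega
      have h1 := htri x y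
      have h2 := htri y x
      have h3 := htri x x
      have h4 := htri y y
      rw [SimpleGraph.dist_self] at h3 h4
      have ha := h a
      have hb := h b
      omega

theorem val_le_add_length_of_walk_pathGraph {n : ℕ} {i j : Fin n}
    (p : (SimpleGraph.pathGraph n).Walk i j) : j.val ≤ i.val + p.length := by
  induction p with
  | nil => simp
  | cons h q ih =>
    rw [SimpleGraph.pathGraph_adj] at h
    rw [SimpleGraph.Walk.length_cons]
    omega

/-- A path has fewer edges than there are vertices; conversely each edge raises the index by at most
1, so the path between the extreme vertices has at least `n - 1` edges. -/
theorem length_longest_path_pathGraph [Fintype V] (hG : G.IsTree) {a b : V} {P : G.Walk a b}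
    (hP : P.IsPath) (hlongest : ∀ (x y : V) (Q : G.Walk x y), Q.IsPath → Q.length ≤ P.length)
    {n : ℕ} (φ : SimpleGraph.pathGraph n ≃g G) : P.length + 1 = n := by
  have hcard : Fintype.card V = n := by
    rw [← Fintype.card_congr φ.toEquiv, Fintype.card_fin]
  have h1 := hP.length_lt
  have hn : 0 < n := by omega
  obtain ⟨Q, hQ, -⟩ := (hG.connected (φ ⟨0, hn⟩) (φ ⟨n - 1, by omega⟩)).exists_path_of_dist
  have h2 := hlongest _ _ Q hQ
  have h3 := val_le_add_length_of_walk_pathGraph (Q.map φ.symm.toHom)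
  rw [SimpleGraph.Walk.length_map] at h3
  simp at h3
  omega

theorem natCeil_half (n : ℕ) : ⌈(n : ℝ) / 2⌉₊ = (n + 1) / 2 := by
  refine le_antisymm (Nat.ceil_le.2 ?_) ?_
  · rw [div_le_iff₀ two_pos]
    exact_mod_cast (by omega : n ≤ (n + 1) / 2 * 2)
  · have h := Nat.le_ceil ((n : ℝ) / 2)
    rw [div_le_iff₀ two_pos] at h
    have h' : n ≤ ⌈(n : ℝ) / 2⌉₊ * 2 := by exact_mod_cast h
    omega

end EdgeRadius

/-! ### The two bounds on the step number -/

section Cost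

variable {V : Type u} [Fintype V] [DecidableEq V] {T : SimpleGraph V} [DecidableRel T.Adj]
  {D : V → Type u} [∀ v, Fintype (D v)] [∀ v, DecidableEq (D v)]

theorem stepNumber_le_edgeRadius (hT : T.Connected) {ρ : Op D} (hρ : IsPure ρ) :
    stepNumber T ρ ≤ edgeRadius T := by
  refine le_iInf₂ fun e he => ?_
  induction e using Sym2.ind with
  | _ x y =>
    by_cases htop : (⨆ u : V, ⨅ v ∈ s(x, y), T.edist u v) = ⊤
    · rw [htop]
      exact le_top
    · obtain ⟨n, hn⟩ := ENat.ne_top_iff_exists.1 htop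
      obtain ⟨r, hr⟩ := exists_routing hT he ((iSup_iInf_edist_le_iff hT).1 hn.ge)
      rw [← hn]
      have hmem : n ∈ {k : ℕ | ρ ∈ closure (preparable T k)} :=
        subset_closure (mem_preparable_of_routing r hρ hr)
      exact iInf₂_le n hmem

theorem edgeRadius_le_stepNumber (hT : T.IsTree) {ρ : Op D} {a b : V} (hab : a ≠ b)
    {P : T.Walk a b} (hP : P.IsPath)
    (hlongest : ∀ (x y : V) (Q : T.Walk x y), Q.IsPath → Q.length ≤ P.length)
    (hent : IsEntangled (reducedPair ρ a b)) : edgeRadius T ≤ stepNumber T ρ := by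
  rw [edgeRadius_eq hT hP hab hlongest]
  refine le_iInf₂ fun k hk => ?_
  rw [Nat.cast_le]
  -- `k < P.length / 2` gives `2 * k + 1 < P.length`, and in a tree no walk from `a` to `b` is
  -- shorter than `P`.
  by_contra! hlt
  refine hent (isSeparable_reducedPair_of_mem_closure (fun p => ?_) hk)
  have := SimpleGraph.dist_le p
  rw [dist_eq_length_of_isPath hT hP] at this
  omega

end Cost

end QNet

theorem mainTheorem4 {V : Type u} [Fintype V] [DecidableEq V] (T : SimpleGraph V)
    [DecidableRel T.Adj] (hT : T.IsTree)
    (D : V → Type u) [∀ v, Fintype (D v)] [∀ v, DecidableEq (D v)]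
    (ρ : QNet.Op D) (hρ : QNet.IsPure ρ)
    (a b : V) (hab : a ≠ b) (P : T.Walk a b) (hP : P.IsPath)
    (hlongest : ∀ (x y : V) (Q : T.Walk x y), Q.IsPath → Q.length ≤ P.length)
    (hent : QNet.IsEntangled (QNet.reducedPair ρ a b)) :
    QNet.communicationCost T ρ = (QNet.edgeRadius T : ℝ≥0∞) ∧
      IsLeast (QNet.averageSteps T ρ) (QNet.edgeRadius T : ℝ≥0∞) ∧
      ∀ n : ℕ, Nonempty (SimpleGraph.pathGraph n ≃g T) →
        QNet.communicationCost T ρ = ((⌈(n : ℝ) / 2⌉₊ - 1 : ℕ) : ℝ≥0∞) := by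
  have hcost : QNet.averageSteps T ρ = {(QNet.edgeRadius T : ℝ≥0∞)} := by
    rw [QNet.averageSteps_eq_of_isPure T hρ, le_antisymm
      (QNet.stepNumber_le_edgeRadius hT.connected hρ)
      (QNet.edgeRadius_le_stepNumber hT hab hP hlongest hent)]
  have hmain : QNet.communicationCost T ρ = (QNet.edgeRadius T : ℝ≥0∞) := by
    rw [QNet.communicationCost, hcost, sInf_singleton]
  refine ⟨hmain, hcost ▸ isLeast_singleton, ?_⟩
  rintro n ⟨φ⟩
  have hlen := QNet.length_longest_path_pathGraph hT hP hlongest φ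
  rw [hmain, QNet.edgeRadius_eq hT hP hab hlongest, ENat.toENNReal_coe, QNet.natCeil_half]
  congr 1
  omega
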